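/- Let $\mathcal G$ be the radial graph of $\mathbb Z^2$: its vertices are the points of $\mathbb Z^2$ and of $\mathbb Z^2+(\tfrac12,\tfrac12)$; two points of $\mathbb Z^2$ at distance $1$ are adjacent, and a point of $\mathbb Z^2$ is adjacent to a point of $\mathbb Z^2+(\tfrac12,\tfrac12)$ at distance $\tfrac{\sqrt2}{2}$ from it; there are no other edges. For integers $m,n\ge 0$ with $m+n$ odd let $G=G^{(m,n)}$ be the subgraph of $\mathcal G$ induced by the vertices in $[0,m]\times[0,n]$, and let $k=\frac{m+n+1}{2}$. Let $V_1$ (resp. $V_2$) be the set of the vertices $(x,y)\in\mathbb Z^2$ of $G$ with $x-y$ even (resp. odd), let $V_3$ be the set of the vertices of $G$ in $\mathbb Z^2+(\tfrac12,\tfrac12)$, and let $E_2$ be the set of the edges of $G$ with both endpoints in $V_1\cup V_2$. For $j=1,2$ let $G_j$ be the graph on $V_j$ in which two distinct vertices $x,y$ are adjacent iff there is a $z\in V_3$ (a middle vertex of the edge $xy$) that is adjacent in $G$ to both $x$ and $y$. A dimer covering of $G$ is a set $M$ of edges of $G$ such that each vertex of $G$ lies on exactly one edge of $M$. Let $\mathcal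 D(G)$ be the set of dimer coverings of $G$, and let $\mathcal F(G,P)$ be the set of triples $(F_1,F_2,\{e_j\}_{j=1}^k)$ in which $F_j$ is a spanning forest of $G_j$ with exactly $k$ components (single vertices are allowed as components) for $j=1,2$, and $\{e_j\}_{j=1}^k\subset E_2$ is a set of $k$ edges (impurities), such that (P)(1) no vertex of $V_3$ is a middle vertex both of an edge of $F_1$ and of an edge of $F_2$; (P)(2) the impurities pair the trees of $F_1$ with the trees of $F_2$: there is a bijection $\sigma$ from the components of $F_1$ to the components of $F_2$ such that each component $T$ of $F_1$ is joined to $\sigma(T)$ by exactly one of the $e_j$, and each $e_j$ joins some $T$ to $\sigma(T)$. Then there is a bijection $\mathcal D(G)\to\mathcal F(G,P)$. More precisely, there is one that sends each $M\in\mathcal D(G)$ to the triple in which $\{e_j\}=M\cap E_2$, and in which an edge $xy$ of $G_j$ belongs to $F_j$ iff $M$ contains an edge joining a middle vertex of $xy$ to $x$ or to $y$. -/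

import Mathlib

namespace RadialGraph

/-- The vertices of the radial graph of `ℤ²`: `Sum.inl (x, y)` is the lattice point `(x, y)` and
`Sum.inr (x, y)` is the point `(x + 1/2, y + 1/2)`, the centre of the unit face whose lower left
corner is `(x, y)`. -/
abbrev Vertex : Type := (ℤ × ℤ) ⊕ (ℤ × ℤ)

/-- Adjacency in the radial graph. A lattice point is adjacent to the lattice points at distance
`1`, and to the centres of the four faces that have it as a corner, which are the centres at
distance `√2 / 2`. Two centres are never adjacent. -/
def adj : Vertex → Vertex → Prop
  | Sum.inl p, Sum.inl q => (p.1 - q.1) ^ 2 + (p.2 - q.2) ^ 2 = 1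
  | Sum.inl p, Sum.inr q => (p.1 = q.1 ∨ p.1 = q.1 + 1) ∧ (p.2 = q.2 ∨ p.2 = q.2 + 1)
  | Sum.inr q, Sum.inl p => (p.1 = q.1 ∨ p.1 = q.1 + 1) ∧ (p.2 = q.2 ∨ p.2 = q.2 + 1)
  | Sum.inr _, Sum.inr _ => False

/-- The radial graph of `ℤ²`. -/
def radialGraph : SimpleGraph Vertex where
  Adj := adj
  symm := ⟨by
    rintro (p | p) (q | q) h
    · simp only [adj] at h ⊢
      linarith [h, sub_sq_comm p.1 q.1, sub_sq_comm p.2 q.2]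
    · exact h
    · exact h
    · exact h⟩
  loopless := ⟨by
    rintro (p | p) h
    · simp [adj] at h
    · exact h⟩

/-- The vertices of the rectangle with `m` blocks in the horizontal and `n` blocks in the vertical
direction: the lattice points of `[0, m] × [0, n]` and the centres of its `m * n` unit faces. -/
def rectSet (m n : ℕ) : Set Vertex :=
  {v | match v with
    | Sum.inl p => (0 ≤ p.1 ∧ p.1 ≤ m) ∧ (0 ≤ p.2 ∧ p.2 ≤ n)
    | Sum.inr q => (0 ≤ q.1 ∧ q.1 < m) ∧ (0 ≤ q.2 ∧ q.2 < n)}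

/-- The rectangle `G^{(m,n)}`, as an induced subgraph of the radial graph. -/
def rect (m n : ℕ) : SimpleGraph (rectSet m n) := radialGraph.induce (rectSet m n)

/-- The vertices of the rectangle that are lattice points with even coordinate difference. -/
def V₁ (m n : ℕ) : Set (rectSet m n) := {v | ∃ x y : ℤ, v.1 = Sum.inl (x, y) ∧ Even (x - y)}

/-- The vertices of the rectangle that are lattice points with odd coordinate difference. -/
def V₂ (m n : ℕ) : Set (rectSet m n) := {v | ∃ x y : ℤ, v.1 = Sum.inl (x, y) ∧ Odd (x - y)}

/-- The vertices of the rectangle that are centres of unit faces. -/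
def V₃ (m n : ℕ) : Set (rectSet m n) := {v | ∃ x y : ℤ, v.1 = Sum.inr (x, y)}

/-- The edges of the rectangle between lattice points. -/
def E₂ (m n : ℕ) : Set (Sym2 (rectSet m n)) :=
  {e | e ∈ (rect m n).edgeSet ∧ ∀ v ∈ e, v ∈ V₁ m n ∪ V₂ m n}

/-- A dimer covering of a graph: a set of edges such that every vertex lies on exactly one of
them. -/
def DimerCovering {V : Type*} (G : SimpleGraph V) : Type _ :=
  {M : Set (Sym2 V) // M ⊆ G.edgeSet ∧ ∀ x : V, ∃! e, e ∈ M ∧ x ∈ e}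

/-- `z` is a middle vertex of `x` and `y`: a face centre adjacent to both. -/
def IsMiddle {m n : ℕ} (z x y : rectSet m n) : Prop :=
  z ∈ V₃ m n ∧ (rect m n).Adj x z ∧ (rect m n).Adj z y

/-- The graph on a set `W` of vertices of the rectangle (used for `W = V₁` and `W = V₂`) in which
two distinct vertices are adjacent iff they have a middle vertex. -/
def middleGraph {m n : ℕ} (W : Set (rectSet m n)) : SimpleGraph W where
  Adj x y := x ≠ y ∧ ∃ z, IsMiddle z (x : rectSet m n) y
  symm := ⟨by
    rintro x y ⟨hne, z, hz, hxz, hzy⟩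
    exact ⟨hne.symm, z, hz, hzy.symm, hxz.symm⟩⟩
  loopless := ⟨fun _ h => h.1 rfl⟩

/-- The graph `G₁`, on the vertex class `V₁`. -/
def G₁ (m n : ℕ) : SimpleGraph (V₁ m n) := middleGraph (V₁ m n)

/-- The graph `G₂`, on the vertex class `V₂`. -/
def G₂ (m n : ℕ) : SimpleGraph (V₂ m n) := middleGraph (V₂ m n)

/-- `F` is a spanning forest of `G` with `k` components. It contains all vertices, so that an
isolated vertex of `F` is a component. -/
def IsSpanningForest {V : Type*} (G F : SimpleGraph V) (k : ℕ) : Prop :=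
  F ≤ G ∧ F.IsAcyclic ∧ Nat.card F.ConnectedComponent = k

/-- `F₁` and `F₂` do not intersect: no middle vertex is on both an edge of `F₁` and an edge of
`F₂`. -/
def NoIntersection {m n : ℕ} (F₁ : SimpleGraph (V₁ m n)) (F₂ : SimpleGraph (V₂ m n)) : Prop :=
  ∀ (x x' : V₁ m n) (y y' : V₂ m n) (z : rectSet m n),
    F₁.Adj x x' → F₂.Adj y y' → IsMiddle z (x : rectSet m n) x' →
      ¬ IsMiddle z (y : rectSet m n) y'

/-- The edge `e` joins the component `c₁` of `F₁` with the component `c₂` of `F₂`. -/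
def Joins {m n : ℕ} {F₁ : SimpleGraph (V₁ m n)} {F₂ : SimpleGraph (V₂ m n)}
    (e : Sym2 (rectSet m n)) (c₁ : F₁.ConnectedComponent) (c₂ : F₂.ConnectedComponent) : Prop :=
  ∃ (x : V₁ m n) (y : V₂ m n), e = s((x : rectSet m n), (y : rectSet m n)) ∧
    F₁.connectedComponentMk x = c₁ ∧ F₂.connectedComponentMk y = c₂

/-- The edges in `I` pair the components of `F₁` with those of `F₂`: for some one-to-one
correspondence `σ` between the components, each component `c` of `F₁` is joined with `σ c` by
exactly one edge of `I`, and every edge of `I` joins some `c` with `σ c`. -/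
def Pairs {m n : ℕ} (I : Set (Sym2 (rectSet m n)))
    (F₁ : SimpleGraph (V₁ m n)) (F₂ : SimpleGraph (V₂ m n)) : Prop :=
  ∃ σ : F₁.ConnectedComponent ≃ F₂.ConnectedComponent,
    (∀ c, ∃! e, e ∈ I ∧ Joins e c (σ c)) ∧ ∀ e ∈ I, ∃ c, Joins e c (σ c)

/-- The triples `(F₁, F₂, {e_j})` of spanning forests with `k` components and a set of `k` edges
between lattice points that satisfy condition (P). -/
structure PairedForests (m n k : ℕ) where
  /-- the forest on `G₁` -/
  F₁ : SimpleGraph (V₁ m n)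
  /-- the forest on `G₂` -/
  F₂ : SimpleGraph (V₂ m n)
  /-- the set of impurities -/
  impurities : Set (Sym2 (rectSet m n))
  forest₁ : IsSpanningForest (G₁ m n) F₁ k
  forest₂ : IsSpanningForest (G₂ m n) F₂ k
  impurities_subset : impurities ⊆ E₂ m n
  impurities_ncard : impurities.ncard = k
  noIntersection : NoIntersection F₁ F₂
  pairs : Pairs impurities F₁ F₂

/-- Two vertices `x`, `y` have a middle vertex that is matched by `M` to one of them. -/
def MatchedMiddle {m n : ℕ} (M : Set (Sym2 (rectSet m n))) (x y : rectSet m n) : Prop :=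
  ∃ z, IsMiddle z x y ∧ (s(x, z) ∈ M ∨ s(z, y) ∈ M)

end RadialGraph

/-! The two corners of one parity in a unit face are opposite to each other, so each face centre is
the middle vertex of exactly one edge of `G₁` and of one edge of `G₂`. In a covering, send each
lattice point matched with a face centre to the opposite corner of that face (`next`), and call the
points matched with lattice points roots. If this map has no cycles, it is the flow towards the
roots of two forests. These do not intersect, because a face centre has only one mate, and the
impurities pair their roots. Comparing the $(m+1)(n+1)$ lattice points with the $mn$ faces leaves
$m+n+1$ roots, half of them in each class.

The substance is the absence of cycles (`next_terminates`). By a mod 2 Jordan theorem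
(`exists_enclosed`) a cycle encloses a nonempty set of interior points of the other class that no
arrow of `next` enters or leaves. Such a set contains no root (`next_ne_of_enclosed`): the faces on
its boundary are matched to the other class and, by counting, use up all points of that class that
they touch. The mate of an enclosed root is therefore untouched, and the points flowing to it form
an enclosed set with a root and a smaller bound on the first coordinate, which cannot go on forever.
The set inside the cycle, being rootless, contains another cycle with smaller coordinate sums, and
this descent also ends.

Conversely, the impurities determine the roots, and a forest with roots has exactly one flow
(`exists_isFlow`, `IsFlow.unique`). Matching each non-root with the middle vertex of the edge to its
parent is injective by acyclicity and non-intersection, and reaches every face centre by the same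
count. -/

namespace RadialGraph

/-! ### Faces, corners and the opposite-corner map of a matching -/

/-- `v` is a corner of the unit face with centre `z + (1/2, 1/2)`. -/
def Corner (v z : ℤ × ℤ) : Prop := (v.1 = z.1 ∨ v.1 = z.1 + 1) ∧ (v.2 = z.2 ∨ v.2 = z.2 + 1)

/-- The corner of the face `z` opposite to the corner `p`. -/
def opp (z p : ℤ × ℤ) : ℤ × ℤ := (2 * z.1 + 1 - p.1, 2 * z.2 + 1 - p.2)

/-- `mate` is a perfect matching of the rectangle, given as an involution. -/
structure Mating (m n : ℕ) (mate : Vertex → Vertex) : Prop where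
  mem : ∀ v ∈ rectSet m n, mate v ∈ rectSet m n
  adj : ∀ v ∈ rectSet m n, RadialGraph.adj v (mate v)
  invol : ∀ v ∈ rectSet m n, mate (mate v) = v

/-- The corner opposite to `p` of the face matched with `p`; `p` itself if `p` is matched with a
lattice point. -/
def next (mate : Vertex → Vertex) (p : ℤ × ℤ) : ℤ × ℤ :=
  match mate (Sum.inl p) with
  | Sum.inl _ => p
  | Sum.inr z => opp z p

/-- Lattice points of the parity class `ε`. -/
def Par (ε : ℤ) (p : ℤ × ℤ) : Prop := (p.1 + p.2 + ε) % 2 = 0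

lemma mem_rectSet_inl {m n : ℕ} {p : ℤ × ℤ} :
    (Sum.inl p : Vertex) ∈ rectSet m n ↔ (0 ≤ p.1 ∧ p.1 ≤ m) ∧ (0 ≤ p.2 ∧ p.2 ≤ n) := Iff.rfl

lemma mem_rectSet_inr {m n : ℕ} {p : ℤ × ℤ} :
    (Sum.inr p : Vertex) ∈ rectSet m n ↔ (0 ≤ p.1 ∧ p.1 < m) ∧ (0 ≤ p.2 ∧ p.2 < n) := Iff.rfl

lemma corner_opp {v z : ℤ × ℤ} (h : Corner v z) : Corner (opp z v) z := by
  simp only [Corner, opp] at *; omega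

lemma par_opp {ε : ℤ} {v z : ℤ × ℤ} : Par ε (opp z v) ↔ Par ε v := by
  simp only [Par, opp] at *; omega

lemma opp_ne (z v : ℤ × ℤ) : opp z v ≠ v := by
  intro h; have := congrArg Prod.fst h; simp only [opp] at this; omega

lemma eq_or_eq_opp {ε : ℤ} {v c z : ℤ × ℤ} (hv : Corner v z) (hc : Corner c z) (pv : Par ε v)
    (pc : Par ε c) : v = c ∨ v = opp z c := by
  obtain ⟨a, b⟩ := v; obtain ⟨c, d⟩ := c; obtain ⟨e, f⟩ := z
  simp only [Corner, Par, opp, Prod.mk.injEq] at *; omega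

lemma corner_mem {m n : ℕ} {v z : ℤ × ℤ} (hv : Corner v z) (hz : Sum.inr z ∈ rectSet m n) :
    Sum.inl v ∈ rectSet m n := by
  rw [mem_rectSet_inl]; rw [mem_rectSet_inr] at hz; simp only [Corner] at *; omega

lemma face_mem {m n : ℕ} {v z : ℤ × ℤ} (hv : Corner v z)
    (h : 0 < v.1 ∧ v.1 < m ∧ 0 < v.2 ∧ v.2 < n) : Sum.inr z ∈ rectSet m n := by
  rw [mem_rectSet_inr]; simp only [Corner] at *; omega

lemma next_of_inr {mate : Vertex → Vertex} {p z : ℤ × ℤ} (h : mate (Sum.inl p) = Sum.inr z) :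
    next mate p = opp z p := by simp [next, h]

lemma next_of_inl {mate : Vertex → Vertex} {p z : ℤ × ℤ} (h : mate (Sum.inl p) = Sum.inl z) :
    next mate p = p := by simp [next, h]

lemma next_eq_self_iff {mate : Vertex → Vertex} {p : ℤ × ℤ} :
    next mate p = p ↔ ∃ q, mate (Sum.inl p) = Sum.inl q := by
  rcases h : mate (Sum.inl p) with q | z
  · simp [next_of_inl h]
  · simp [next_of_inr h, opp_ne]

lemma par_next {mate : Vertex → Vertex} {ε : ℤ} {p : ℤ × ℤ} :
    Par ε (next mate p) ↔ Par ε p := by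
  rcases h : mate (Sum.inl p) with q | z
  · simp [next_of_inl h]
  · simp [next_of_inr h, par_opp]

namespace Mating
variable {m n : ℕ} {mate : Vertex → Vertex}

lemma exists_corner (h : Mating m n mate) {z : ℤ × ℤ} (hz : Sum.inr z ∈ rectSet m n) :
    ∃ c, mate (Sum.inr z) = Sum.inl c ∧ Corner c z ∧ mate (Sum.inl c) = Sum.inr z := by
  have ha := h.adj _ hz
  have hi := h.invol _ hz
  rcases hc : mate (Sum.inr z) with c | c
  · rw [hc] at ha hi
    exact ⟨c, rfl, ha, hi⟩
  · rw [hc] at ha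
    exact ha.elim

lemma corner_of_inr (h : Mating m n mate) {p z : ℤ × ℤ} (hp : Sum.inl p ∈ rectSet m n)
    (hz : mate (Sum.inl p) = Sum.inr z) :
    Corner p z ∧ Sum.inr z ∈ rectSet m n ∧ mate (Sum.inr z) = Sum.inl p := by
  have h1 := h.adj _ hp
  have h2 := h.invol _ hp
  have h3 := h.mem _ hp
  rw [hz] at h1 h2 h3
  exact ⟨h1, h3, h2⟩

lemma next_mem (h : Mating m n mate) {p : ℤ × ℤ} (hp : Sum.inl p ∈ rectSet m n) :
    Sum.inl (next mate p) ∈ rectSet m n := by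
  rcases hq : mate (Sum.inl p) with q | z
  · rwa [next_of_inl hq]
  · rw [next_of_inr hq]
    have := h.corner_of_inr hp hq
    exact corner_mem (corner_opp this.1) this.2.1

lemma iterate_next_mem (h : Mating m n mate) {p : ℤ × ℤ} (hp : Sum.inl p ∈ rectSet m n) (k : ℕ) :
    Sum.inl ((next mate)^[k] p) ∈ rectSet m n := by
  induction k with
  | zero => exact hp
  | succ k ih => rw [Function.iterate_succ_apply']; exact h.next_mem ih

end Mating

lemma finite_inl (m n : ℕ) : {p : ℤ × ℤ | Sum.inl p ∈ rectSet m n}.Finite := by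
  refine ((Set.finite_Icc (0 : ℤ) m).prod (Set.finite_Icc (0 : ℤ) n)).subset ?_
  intro p hp
  exact ⟨⟨hp.1.1, hp.1.2⟩, hp.2.1, hp.2.2⟩

lemma finite_inr (m n : ℕ) : {p : ℤ × ℤ | Sum.inr p ∈ rectSet m n}.Finite := by
  refine (finite_inl m n).subset ?_
  intro p hp
  simp only [Set.mem_ofPred_eq, mem_rectSet_inl, mem_rectSet_inr] at *
  omega

/-! ### Enclosed unions of components contain no root -/

namespace Mating
variable {m n : ℕ} {mate : Vertex → Vertex}

/-- If every point of class `ε` touched by the face set `E` is touched at least twice, and all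
faces of `E` are matched to points of class `ε`, then the touched points are matched into `E`. -/
lemma mate_mem_of_touched (h : Mating m n mate) {ε : ℤ} {E : Set (ℤ × ℤ)}
    (hE : ∀ z ∈ E, Sum.inr z ∈ rectSet m n)
    (hpar : ∀ z ∈ E, ∀ c, mate (Sum.inr z) = Sum.inl c → Par ε c)
    (htwo : ∀ v, Par ε v → ∀ z ∈ E, Corner v z → ∃ z' ∈ E, z' ≠ z ∧ Corner v z')
    {v : ℤ × ℤ} (hv : Par ε v) {z : ℤ × ℤ} (hz : z ∈ E) (hvz : Corner v z) :
    ∃ z' ∈ E, mate (Sum.inl v) = Sum.inr z' := by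
  classical
  have hfin : E.Finite := (finite_inr m n).subset hE
  choose! c hc using fun z (hz : z ∈ E) => h.exists_corner (hE z hz)
  set T : Set (ℤ × ℤ) := {v | Par ε v ∧ ∃ z ∈ E, Corner v z}
  have hcT : Set.MapsTo c E T := fun z hz => ⟨hpar z hz _ (hc z hz).1, z, hz, (hc z hz).2.1⟩
  have hinj : Set.InjOn c E := by
    intro z hz z' hz' e
    have h1 := (hc z hz).2.2
    have h2 := (hc z' hz').2.2
    rw [e, h2] at h1
    exact (Sum.inr.inj h1).symm
  -- A touched point lies on two faces of `E` and is the mate of at most one of them, so it is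
  -- opposite to the mate of another. Hence there are at most as many touched points as faces, and
  -- the injection `c` is onto.
  have hsurj : Set.SurjOn (fun z => opp z (c z)) E T := by
    rintro w ⟨hw, z, hz, hwz⟩
    obtain ⟨z', hz', hne, hwz'⟩ := htwo w hw z hz hwz
    rcases eq_or_eq_opp hwz (hc z hz).2.1 hw (hcT hz).1 with e | e
    · rcases eq_or_eq_opp hwz' (hc z' hz').2.1 hw (hcT hz').1 with e' | e'
      · exact absurd (hinj hz' hz (e'.symm.trans e)) hne
      · exact ⟨z', hz', e'.symm⟩
    · exact ⟨z, hz, e.symm⟩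
  have hTfin : T.Finite := (hfin.image _).subset hsurj
  have hcard : T.ncard ≤ E.ncard :=
    (Set.ncard_le_ncard hsurj (hfin.image _)).trans (Set.ncard_image_le hfin)
  have himg : c '' E = T :=
    Set.eq_of_subset_of_ncard_le hcT.image_subset
      (by rw [hinj.ncard_image]; exact hcard) hTfin
  obtain ⟨z', hz', rfl⟩ : v ∈ c '' E := himg ▸ ⟨hv, z, hz, hvz⟩
  exact ⟨z', hz', (hc z' hz').2.2⟩

end Mating

/-- The faces that separate `R`, a set of points of class `ε`, from the other points of that
class. -/
def bdry (ε : ℤ) (R : Set (ℤ × ℤ)) : Set (ℤ × ℤ) :=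
  {z | ∃ p q, Corner p z ∧ Corner q z ∧ Par ε p ∧ Par ε q ∧ p ∈ R ∧ q ∉ R}

lemma mem_bdry_iff {ε : ℤ} {R : Set (ℤ × ℤ)} {p q z : ℤ × ℤ} (hp : Corner p z) (hq : Corner q z)
    (pp : Par ε p) (pq : Par ε q) (hne : p ≠ q) : z ∈ bdry ε R ↔ ¬ (p ∈ R ↔ q ∈ R) := by
  have hqp : q = opp z p := (eq_or_eq_opp hq hp pq pp).resolve_left hne.symm
  subst hqp
  constructor
  · rintro ⟨a, b, ha, hb, pa, pb, haR, hbR⟩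
    rcases eq_or_eq_opp ha hp pa pp with rfl | rfl <;>
      rcases eq_or_eq_opp hb hp pb pp with rfl | rfl <;> tauto
  · intro h
    by_cases hpR : p ∈ R
    · exact ⟨_, _, hp, hq, pp, pq, hpR, by tauto⟩
    · exact ⟨_, _, hq, hp, pq, pp, by tauto, hpR⟩

/-- Each of the four faces around a point of class `ε + 1` has two cyclically consecutive neighbours
of that point as its corners of class `ε`. -/
lemma bdry_around {ε : ℤ} {R : Set (ℤ × ℤ)} {a b : ℤ} (hv : Par (ε + 1) (a, b)) :
    ((a, b) ∈ bdry ε R ↔ ¬ ((a + 1, b) ∈ R ↔ (a, b + 1) ∈ R)) ∧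
    ((a - 1, b) ∈ bdry ε R ↔ ¬ ((a, b + 1) ∈ R ↔ (a - 1, b) ∈ R)) ∧
    ((a - 1, b - 1) ∈ bdry ε R ↔ ¬ ((a - 1, b) ∈ R ↔ (a, b - 1) ∈ R)) ∧
    ((a, b - 1) ∈ bdry ε R ↔ ¬ ((a, b - 1) ∈ R ↔ (a + 1, b) ∈ R)) := by
  simp only [Par] at hv
  refine ⟨?_, ?_, ?_, ?_⟩ <;> apply mem_bdry_iff <;>
    first
    | simp [Corner]
    | (simp only [Par]; omega)

lemma corner_cases {v z : ℤ × ℤ} (h : Corner v z) : z = (v.1, v.2) ∨ z = (v.1 - 1, v.2) ∨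
    z = (v.1 - 1, v.2 - 1) ∨ z = (v.1, v.2 - 1) := by
  obtain ⟨a, b⟩ := v; obtain ⟨e, f⟩ := z
  simp only [Corner, Prod.mk.injEq] at *; omega

/-- On a walk around `v` through its four neighbours, membership in `R` changes an even number of
times, so a separating face is never alone. -/
lemma exists_ne_mem_bdry {ε : ℤ} {R : Set (ℤ × ℤ)} {v z : ℤ × ℤ} (hv : Par (ε + 1) v)
    (hz : z ∈ bdry ε R) (hvz : Corner v z) : ∃ z' ∈ bdry ε R, z' ≠ z ∧ Corner v z' := by
  obtain ⟨a, b⟩ := v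
  obtain ⟨h1, h2, h3, h4⟩ := bdry_around (R := R) hv
  by_contra! hcon
  have k1 := fun h hne => hcon (a, b) h hne (by simp [Corner])
  have k2 := fun h hne => hcon (a - 1, b) h hne (by simp [Corner])
  have k3 := fun h hne => hcon (a - 1, b - 1) h hne (by simp [Corner])
  have k4 := fun h hne => hcon (a, b - 1) h hne (by simp [Corner])
  have ha : ¬ a = a - 1 := by omega
  have hb : ¬ b = b - 1 := by omega
  have ha' : ¬ a - 1 = a := by omega
  have hb' : ¬ b - 1 = b := by omega
  clear hcon
  rcases corner_cases hvz with rfl | rfl | rfl | rfl <;>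
    simp only [ne_eq, Prod.mk.injEq, ha, hb, ha', hb', and_false, false_and, not_false_eq_true,
      imp_false] at hz k1 k2 k3 k4 <;> grind

/-- Unless `v` is touched by the boundary of `R`, its four neighbours are all in `R` or all
outside. -/
lemma neighbours_mem {ε : ℤ} {R : Set (ℤ × ℤ)} {v r z : ℤ × ℤ} (hv : Par (ε + 1) v)
    (hr : r ∈ R) (pr : Par ε r) (hrz : Corner r z) (hvz : Corner v z)
    (hnot : ∀ z ∈ bdry ε R, ¬ Corner v z) :
    (v.1 + 1, v.2) ∈ R ∧ (v.1, v.2 + 1) ∈ R ∧ (v.1 - 1, v.2) ∈ R ∧ (v.1, v.2 - 1) ∈ R := by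
  obtain ⟨a, b⟩ := v
  obtain ⟨h1, h2, h3, h4⟩ := bdry_around (R := R) hv
  have k1 := fun h => hnot (a, b) h (by simp [Corner])
  have k2 := fun h => hnot (a - 1, b) h (by simp [Corner])
  have k3 := fun h => hnot (a - 1, b - 1) h (by simp [Corner])
  have k4 := fun h => hnot (a, b - 1) h (by simp [Corner])
  have : r = (a + 1, b) ∨ r = (a, b + 1) ∨ r = (a - 1, b) ∨ r = (a, b - 1) := by
    obtain ⟨c, d⟩ := r; obtain ⟨e, f⟩ := z
    simp only [Corner, Par, Prod.mk.injEq] at *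
    omega
  rcases this with rfl | rfl | rfl | rfl <;> tauto

namespace Mating
variable {m n : ℕ} {mate : Vertex → Vertex}

/-- A set of points of one class in the interior of the rectangle that is a union of components
contains no point that is matched with a lattice point. -/
theorem next_ne_of_enclosed (h : Mating m n mate) (N : ℕ) : ∀ (ε : ℤ) (R : Set (ℤ × ℤ)),
    (∀ p ∈ R, Par ε p ∧ (0 < p.1 ∧ p.1 < m ∧ 0 < p.2 ∧ p.2 < n) ∧ p.1 < N) →
    (∀ p, Sum.inl p ∈ rectSet m n → Par ε p → (p ∈ R ↔ next mate p ∈ R)) →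
    ∀ r ∈ R, next mate r ≠ r := by
  induction N with
  | zero =>
    intro ε R hR _ r hr
    have := hR r hr
    simp only [Nat.cast_zero] at this
    omega
  | succ N ih =>
    intro ε R hR hcl r hr hroot
    obtain ⟨w, hw⟩ := next_eq_self_iff.1 hroot
    have memL : ∀ p ∈ R, Sum.inl p ∈ rectSet m n := fun p hp => by
      have := (hR p hp).2.1
      rw [mem_rectSet_inl]; omega
    have hEm : ∀ z ∈ bdry ε R, Sum.inr z ∈ rectSet m n := by
      rintro z ⟨p, q, hp, -, -, -, hpR, -⟩
      exact face_mem hp (hR p hpR).2.1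
    -- A separating face matched within class `ε` would carry an arrow of `next` across the boundary
    -- of `R`.
    have hpar : ∀ z ∈ bdry ε R, ∀ c, mate (Sum.inr z) = Sum.inl c → Par (ε + 1) c := by
      intro z hz c hc
      by_contra hcp
      have hcp' : Par ε c := by simp only [Par] at *; omega
      obtain ⟨c', hc', hcz, hcm⟩ := h.exists_corner (hEm z hz)
      obtain rfl : c = c' := Sum.inl.inj (hc.symm.trans hc')
      have := hcl c (corner_mem hcz (hEm z hz)) hcp'
      rw [next_of_inr hcm] at this
      exact (mem_bdry_iff hcz (corner_opp hcz) hcp' (par_opp.2 hcp') (opp_ne z c).symm).1 hz this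
    have key : ∀ v, Par (ε + 1) v → ∀ z ∈ bdry ε R, Corner v z →
        ∃ z' ∈ bdry ε R, mate (Sum.inl v) = Sum.inr z' := fun v hv z hz hvz =>
      h.mate_mem_of_touched hEm hpar (fun v hv z hz hvz => exists_ne_mem_bdry hv hz hvz) hv hz hvz
    have hrL := memL r hr
    have hwL : Sum.inl w ∈ rectSet m n := hw ▸ h.mem _ hrL
    have hwr : mate (Sum.inl w) = Sum.inl r := hw ▸ h.invol _ hrL
    have hadj : (r.1 - w.1) ^ 2 + (r.2 - w.2) ^ 2 = 1 := by
      have := h.adj _ hrL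
      rw [hw] at this; exact this
    have hadj' : (r.1 = w.1 ∧ (r.2 = w.2 + 1 ∨ r.2 = w.2 - 1)) ∨
        (r.2 = w.2 ∧ (r.1 = w.1 + 1 ∨ r.1 = w.1 - 1)) := by
      have b1 : r.1 - w.1 ≤ 1 := by nlinarith
      have b2 : -1 ≤ r.1 - w.1 := by nlinarith
      have b3 : r.2 - w.2 ≤ 1 := by nlinarith
      have b4 : -1 ≤ r.2 - w.2 := by nlinarith
      generalize hx : r.1 - w.1 = x at *
      generalize hy : r.2 - w.2 = y at *
      have hx' : x = -1 ∨ x = 0 ∨ x = 1 := by omega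
      have hy' : y = -1 ∨ y = 0 ∨ y = 1 := by omega
      rcases hx' with rfl | rfl | rfl <;> rcases hy' with rfl | rfl | rfl <;> omega
    have pw : Par (ε + 1) w := by
      have := (hR r hr).1
      simp only [Par] at *; omega
    -- points that flow to `w` are not touched by the boundary
    have hun : ∀ k v, Par (ε + 1) v → (next mate)^[k] v = w →
        ∀ z ∈ bdry ε R, ¬ Corner v z := by
      intro k
      induction k with
      | zero =>
        rintro v pv rfl z hz hvz
        obtain ⟨z', -, e⟩ := key _ pv z hz hvz
        simp only [Function.iterate_zero, id] at hwr
        rw [e] at hwr; cases hwr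
      | succ k ihk =>
        intro v pv hk z hz hvz
        obtain ⟨z', hz', e⟩ := key _ pv z hz hvz
        rw [Function.iterate_succ_apply] at hk
        refine ihk _ (par_next.2 pv) hk z' hz' ?_
        rw [next_of_inr e]
        exact corner_opp (h.corner_of_inr (corner_mem hvz (hEm z hz)) e).1
    -- The points flowing to `w`. Keeping the four neighbours in `R` makes `Q` interior, and the
    -- right neighbour lowers the bound on the first coordinate from `N + 1` to `N`.
    let Q : Set (ℤ × ℤ) := {v | Par (ε + 1) v ∧ (∃ k, (next mate)^[k] v = w) ∧
      ((v.1 + 1, v.2) ∈ R ∧ (v.1, v.2 + 1) ∈ R ∧ (v.1 - 1, v.2) ∈ R ∧ (v.1, v.2 - 1) ∈ R)}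
    have hwQ : w ∈ Q := by
      refine ⟨pw, ⟨0, rfl⟩, ?_⟩
      -- This face has the edge between `r` and `w` as its left or bottom side.
      refine neighbours_mem (z := (min r.1 w.1, min r.2 w.2)) pw hr (hR r hr).1 ?_ ?_
        (hun 0 w pw rfl) <;> simp only [Corner] <;> omega
    have hQnext : next mate w = w := next_of_inl hwr
    refine ih (ε + 1) Q ?_ ?_ w hwQ hQnext
    · rintro v ⟨pv, -, h1, h2, h3, h4⟩
      have := hR _ h1; have := hR _ h2; have := hR _ h3; have := hR _ h4
      push_cast at *
      refine ⟨pv, ?_, ?_⟩ <;> omega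
    · intro p hpL pp
      rcases hpz : mate (Sum.inl p) with q | z
      · rw [next_of_inl hpz]
      obtain ⟨hpc, hzL, -⟩ := h.corner_of_inr hpL hpz
      have hpn := next_of_inr hpz
      -- the two other corners of `z`
      obtain ⟨s, hsz, ps⟩ : ∃ s, Corner s z ∧ Par ε s := by
        refine ⟨(p.1, 2 * z.2 + 1 - p.2), ?_, ?_⟩ <;> simp only [Corner, Par] at * <;> omega
      have hs : ∀ v, v ∈ Q → Corner v z → s ∈ R := by
        rintro ⟨a, b⟩ ⟨pv, -, h1, h2, h3, h4⟩ hvz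
        have : s = (a + 1, b) ∨ s = (a, b + 1) ∨ s = (a - 1, b) ∨ s = (a, b - 1) := by
          obtain ⟨c, d⟩ := s; obtain ⟨e, f⟩ := z
          simp only [Corner, Par, Prod.mk.injEq] at *
          omega
        rcases this with rfl | rfl | rfl | rfl <;> assumption
      constructor
      · intro hp
        obtain ⟨-, ⟨k, hk⟩, -⟩ := id hp
        have hk' : ∃ k, (next mate)^[k] (next mate p) = w := by
          rcases k with _ | k
          · simp only [Function.iterate_zero, id] at hk
            subst hk
            rw [hpz] at hwr; cases hwr
          · exact ⟨k, by rwa [Function.iterate_succ_apply] at hk⟩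
        obtain ⟨k', hk'⟩ := hk'
        refine ⟨par_next.2 pp, ⟨k', hk'⟩, ?_⟩
        refine neighbours_mem (par_next.2 pp) (hs p hp hpc) ps hsz ?_
          (hun k' _ (par_next.2 pp) hk')
        rw [hpn]; exact corner_opp hpc
      · intro hp
        obtain ⟨-, ⟨k, hk⟩, -⟩ := id hp
        have hk' : (next mate)^[k + 1] p = w := by rwa [Function.iterate_succ_apply]
        refine ⟨pp, ⟨k + 1, hk'⟩, ?_⟩
        exact neighbours_mem pp (hs _ hp (hpn ▸ corner_opp hpc)) ps hsz hpc (hun _ p pp hk')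

end Mating
end RadialGraph

/-! ### A mod 2 Jordan theorem by parities along diagonal rays -/

namespace RadialGraph

/-- The sum of `e` over the faces on the diagonal ray that starts at `y`, up to the right side of
the rectangle. -/
noncomputable def raySum (m : ℕ) (e : ℤ × ℤ → ZMod 2) (y : ℤ × ℤ) : ZMod 2 :=
  ∑ i ∈ Finset.Ico y.1 (m : ℤ), e (i, i + y.2 - y.1)

section Ray
variable {m n : ℕ} {e : ℤ × ℤ → ZMod 2}

lemma raySum_diag (he : ∀ z, e z ≠ 0 → Sum.inr z ∈ rectSet m n) (a b : ℤ) :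
    raySum m e (a, b) = e (a, b) + raySum m e (a + 1, b + 1) := by
  unfold raySum
  by_cases h : a < m
  · rw [← Finset.insert_Ico_add_one_left_eq_Ico h, Finset.sum_insert (by simp)]
    congr 1
    · congr 1; ext <;> simp
    · refine Finset.sum_congr rfl fun i _ => ?_
      congr 1; ext
      · rfl
      · simp only; ring
  · have : e (a, b) = 0 := by
      by_contra hne
      have := mem_rectSet_inr.1 (he _ hne)
      simp only at this; omega
    rw [this, Finset.Ico_eq_empty (by simpa using h), Finset.Ico_eq_empty (by simp; omega)]
    simp

lemma raySum_eq_zero_of_right {y : ℤ × ℤ} (h : (m : ℤ) ≤ y.1) : raySum m e y = 0 := by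
  rw [raySum, Finset.Ico_eq_empty (by omega), Finset.sum_empty]

lemma exists_of_raySum_ne_zero {y : ℤ × ℤ} (h : raySum m e y ≠ 0) :
    ∃ k : ℤ, 0 ≤ k ∧ e (y.1 + k, y.2 + k) ≠ 0 := by
  obtain ⟨i, hi, hne⟩ := Finset.exists_ne_zero_of_sum_ne_zero h
  rw [Finset.mem_Ico] at hi
  refine ⟨i - y.1, by omega, ?_⟩
  convert hne using 3 <;> ring

lemma raySum_eq_zero_of_top (he : ∀ z, e z ≠ 0 → Sum.inr z ∈ rectSet m n) {y : ℤ × ℤ}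
    (h : (n : ℤ) ≤ y.2) : raySum m e y = 0 := by
  by_contra hne
  obtain ⟨k, hk, hne⟩ := exists_of_raySum_ne_zero hne
  have := mem_rectSet_inr.1 (he _ hne)
  simp only at this; omega

/-- Induction from the right side: the rays from two opposite corners of a face run along
neighbouring diagonals, and evenness at the point `(a + 1, b)` between them converts the statement
for `(a + 1, b + 1)` into the one for `(a, b)`. -/
lemma raySum_antidiag {ε : ℤ} (he : ∀ z, e z ≠ 0 → Sum.inr z ∈ rectSet m n)
    (heven : ∀ a b, Par ε (a, b) → e (a, b) + e (a - 1, b) + e (a - 1, b - 1) + e (a, b - 1) = 0)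
    (k : ℕ) : ∀ a b : ℤ, (m : ℤ) ≤ a + k → Par (ε + 1) (a, b) →
      raySum m e (a, b) + raySum m e (a + 1, b - 1) = e (a, b - 1) := by
  have h2 : (2 : ZMod 2) = 0 := rfl
  induction k with
  | zero =>
    intro a b hm _
    rw [raySum_eq_zero_of_right (by simpa using hm),
      raySum_eq_zero_of_right (by push_cast at hm; simp only; omega)]
    by_contra hne
    have := mem_rectSet_inr.1 (he _ (fun h => hne (by rw [h, add_zero])))
    push_cast at hm
    simp only at this; omega
  | succ k ih =>
    intro a b hm hp
    have h1 := ih (a + 1) (b + 1) (by push_cast at hm; omega)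
      (by simp only [Par] at *; omega)
    have h3 := heven (a + 1) b (by simp only [Par] at *; omega)
    rw [raySum_diag he a b, raySum_diag he (a + 1) (b - 1)]
    simp only [add_sub_cancel_right, sub_add_cancel] at *
    linear_combination h1 + h3 - (e (a, b - 1)) * h2

/-- Steps in direction `(-1, 1)` cross only faces outside the rectangle and end above it, where the
ray is empty of faces. -/
lemma raySum_eq_zero_of_left {ε : ℤ} (he : ∀ z, e z ≠ 0 → Sum.inr z ∈ rectSet m n)
    (heven : ∀ a b, Par ε (a, b) → e (a, b) + e (a - 1, b) + e (a - 1, b - 1) + e (a, b - 1) = 0)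
    (k : ℕ) : ∀ a b : ℤ, (n : ℤ) ≤ b + k → a ≤ 0 → Par (ε + 1) (a, b) →
      raySum m e (a, b) = 0 := by
  induction k with
  | zero =>
    intro a b hn _ _
    exact raySum_eq_zero_of_top he (by simpa using hn)
  | succ k ih =>
    intro a b hn ha hp
    have hp' : Par (ε + 1) (a - 1, b + 1) := by simp only [Par] at *; omega
    have h1 := raySum_antidiag he heven (m - (a - 1)).toNat (a - 1) (b + 1) (by omega) hp'
    rw [ih (a - 1) (b + 1) (by push_cast at hn; omega) (by omega) hp'] at h1
    simp only [sub_add_cancel, add_sub_cancel_right, zero_add] at h1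
    rw [h1]
    by_contra hne
    have := mem_rectSet_inr.1 (he _ hne)
    simp only at this; omega

/-- As on the left side, with steps in direction `(1, -1)` that end to the right of the rectangle.
-/
lemma raySum_eq_zero_of_bottom {ε : ℤ} (he : ∀ z, e z ≠ 0 → Sum.inr z ∈ rectSet m n)
    (heven : ∀ a b, Par ε (a, b) → e (a, b) + e (a - 1, b) + e (a - 1, b - 1) + e (a, b - 1) = 0)
    (k : ℕ) : ∀ a b : ℤ, (m : ℤ) ≤ a + k → b ≤ 0 → Par (ε + 1) (a, b) →
      raySum m e (a, b) = 0 := by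
  induction k with
  | zero =>
    intro a b hm _ _
    exact raySum_eq_zero_of_right (by simpa using hm)
  | succ k ih =>
    intro a b hm hb hp
    have h1 := raySum_antidiag he heven (m - a).toNat a b (by omega) hp
    rw [ih (a + 1) (b - 1) (by push_cast at hm; omega) (by omega)
      (by simp only [Par] at *; omega), add_zero] at h1
    rw [h1]
    by_contra hne
    have := mem_rectSet_inr.1 (he _ hne)
    simp only at this; omega

/-- A mod `2` Jordan curve theorem: a set of faces of the rectangle (with indicator function `e`)
that has an even number of faces around each point of class `ε` is the boundary of a set of
interior points of the other class. -/
theorem exists_enclosed {ε : ℤ} (he : ∀ z, e z ≠ 0 → Sum.inr z ∈ rectSet m n)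
    (heven : ∀ a b, Par ε (a, b) → e (a, b) + e (a - 1, b) + e (a - 1, b - 1) + e (a, b - 1) = 0) :
    ∃ S : Set (ℤ × ℤ), (∀ y ∈ S, Par (ε + 1) y ∧ (0 < y.1 ∧ y.1 < m ∧ 0 < y.2 ∧ y.2 < n) ∧
        ∃ k : ℤ, 0 ≤ k ∧ e (y.1 + k, y.2 + k) ≠ 0) ∧
      ∀ z p, Corner p z → Par (ε + 1) p → ((p ∈ S ↔ opp z p ∈ S) ↔ e z = 0) := by
  have iff_add : ∀ x y : ZMod 2, (x ≠ 0 ↔ y ≠ 0) ↔ x + y = 0 := by decide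
  have self_add : ∀ x y : ZMod 2, x + y + y = x := by decide
  -- The inside consists of the points whose ray meets an odd number of faces when `e` is an
  -- indicator function.
  refine ⟨{y | Par (ε + 1) y ∧ raySum m e y ≠ 0}, ?_, ?_⟩
  · rintro ⟨a, b⟩ ⟨hp, hne⟩
    refine ⟨hp, ⟨?_, ?_, ?_, ?_⟩, exists_of_raySum_ne_zero hne⟩ <;> by_contra hcon <;>
      refine hne ?_ <;> simp only [not_lt] at hcon
    · exact raySum_eq_zero_of_left he heven (n - b).toNat a b (by omega) hcon hp
    · exact raySum_eq_zero_of_right hcon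
    · exact raySum_eq_zero_of_bottom he heven (m - a).toNat a b (by omega) hcon hp
    · exact raySum_eq_zero_of_top he hcon
  · intro z p hpz hp
    have hp' : Par (ε + 1) (opp z p) := par_opp.2 hp
    simp only [Set.mem_ofPred_eq, hp, hp', true_and, iff_add]
    obtain ⟨a, b⟩ := z
    have hd := raySum_diag he a b
    have ha := fun h => raySum_antidiag he heven (m - a).toNat a (b + 1) (by omega) h
    obtain ⟨c, d⟩ := p
    simp only [Corner, opp, Par] at *
    obtain ⟨rfl | rfl, rfl | rfl⟩ := hpz
    · rw [show 2 * c + 1 - c = c + 1 by ring, show 2 * d + 1 - d = d + 1 by ring, hd, self_add]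
    · rw [show 2 * c + 1 - c = c + 1 by ring, show 2 * b + 1 - (b + 1) = b by ring]
      have := ha (by omega)
      rw [add_sub_cancel_right] at this
      rw [this]
    · rw [show 2 * a + 1 - (a + 1) = a by ring, show 2 * d + 1 - d = d + 1 by ring]
      have := ha (by omega)
      rw [add_sub_cancel_right, add_comm] at this
      rw [this]
    · rw [show 2 * a + 1 - (a + 1) = a by ring, show 2 * b + 1 - (b + 1) = b by ring,
        add_comm, hd, self_add]

end Ray

/-! ### Absence of cycles -/

namespace Mating
variable {m n : ℕ} {mate : Vertex → Vertex}

open Classical in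
/-- Around each point of class `ε` there is an even number of faces matched with a given periodic
orbit of `next` of class `ε`. -/
lemma orbit_faces_even (h : Mating m n mate) {ε : ℤ} {O : Set (ℤ × ℤ)}
    (hO : ∀ v ∈ O, Sum.inl v ∈ rectSet m n ∧ Par ε v ∧ next mate v ≠ v)
    (hbij : Set.BijOn (next mate) O O) (a b : ℤ) (hab : Par ε (a, b)) :
    let e : ℤ × ℤ → ZMod 2 := fun z => if ∃ v ∈ O, mate (Sum.inl v) = Sum.inr z then 1 else 0
    e (a, b) + e (a - 1, b) + e (a - 1, b - 1) + e (a, b - 1) = 0 := by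
  intro e
  have hface : ∀ v ∈ O, ∃ z, mate (Sum.inl v) = Sum.inr z ∧ Corner v z := by
    intro v hv
    rcases hz : mate (Sum.inl v) with q | z
    · exact absurd (next_of_inl hz) (hO v hv).2.2
    · exact ⟨z, rfl, (h.corner_of_inr (hO v hv).1 hz).1⟩
  have hcase : ∀ z, Corner (a, b) z → (∃ v ∈ O, mate (Sum.inl v) = Sum.inr z) →
      ((a, b) ∈ O ∧ mate (Sum.inl (a, b)) = Sum.inr z) ∨
      ∃ v ∈ O, mate (Sum.inl v) = Sum.inr z ∧ next mate v = (a, b) := by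
    rintro z hc ⟨v, hv, hz⟩
    rcases eq_or_eq_opp hc (h.corner_of_inr (hO v hv).1 hz).1 hab (hO v hv).2.1 with e | e
    · subst e; exact Or.inl ⟨hv, hz⟩
    · exact Or.inr ⟨v, hv, hz, (next_of_inr hz).trans e.symm⟩
  -- A point of the orbit lies on exactly two of its faces, its own mate and the mate of its unique
  -- predecessor; any other point of class `ε` lies on none.
  by_cases hmem : (a, b) ∈ O
  · obtain ⟨z₁, hz₁, hc₁⟩ := hface _ hmem
    obtain ⟨u, hu, hua⟩ := hbij.surjOn hmem
    obtain ⟨z₂, hz₂, hc₂⟩ := hface _ hu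
    have hne : z₁ ≠ z₂ := by
      rintro rfl
      have h1 := (h.corner_of_inr (hO _ hmem).1 hz₁).2.2
      have h2 := (h.corner_of_inr (hO _ hu).1 hz₂).2.2
      have : u = (a, b) := Sum.inl.inj (h2.symm.trans h1)
      exact (hO u hu).2.2 (hua.trans this.symm)
    have hc₂' : Corner (a, b) z₂ := by
      rw [← hua, next_of_inr hz₂]; exact corner_opp hc₂
    have hE : ∀ z, Corner (a, b) z → e z = if z = z₁ ∨ z = z₂ then 1 else 0 := by
      intro z hc
      refine if_congr ⟨fun hz => ?_, ?_⟩ rfl rfl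
      · rcases hcase z hc hz with ⟨-, hz⟩ | ⟨v, hv, hz, hva⟩
        · left; exact Sum.inr.inj (hz.symm.trans hz₁)
        · right
          obtain rfl := hbij.injOn hv hu (hva.trans hua.symm)
          exact Sum.inr.inj (hz.symm.trans hz₂)
      · rintro (rfl | rfl)
        · exact ⟨_, hmem, hz₁⟩
        · exact ⟨_, hu, hz₂⟩
    have ha : ¬ a = a - 1 := by omega
    have hb : ¬ b = b - 1 := by omega
    have ha' : ¬ a - 1 = a := by omega
    have hb' : ¬ b - 1 = b := by omega
    have h11 : (1 : ZMod 2) + 1 = 0 := rfl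
    rw [hE _ (by simp [Corner]), hE _ (by simp [Corner]), hE _ (by simp [Corner]),
      hE _ (by simp [Corner])]
    rcases corner_cases hc₁ with rfl | rfl | rfl | rfl <;>
      rcases corner_cases hc₂' with rfl | rfl | rfl | rfl <;>
      first
      | exact absurd rfl hne
      | simp [ha, hb, ha', hb', h11]
  · have hE : ∀ z, Corner (a, b) z → e z = 0 := by
      intro z hc
      refine if_neg fun hz => ?_
      rcases hcase z hc hz with ⟨hm, -⟩ | ⟨v, hv, -, hva⟩
      · exact hmem hm
      · exact hmem (hva ▸ hbij.mapsTo hv)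
    rw [hE _ (by simp [Corner]), hE _ (by simp [Corner]), hE _ (by simp [Corner]),
      hE _ (by simp [Corner])]
    simp

-- Infinite descent on a strict bound `N` for the coordinate sums along a rootless orbit: such an
-- orbit runs into a cycle, and the points inside the cycle have rootless orbits with a smaller
-- bound.
open Classical in
lemma next_terminates_aux (h : Mating m n mate) (N : ℕ) : ∀ p, Sum.inl p ∈ rectSet m n →
    (∀ k, next mate ((next mate)^[k] p) ≠ (next mate)^[k] p) →
    (∀ k, ((next mate)^[k] p).1 + ((next mate)^[k] p).2 < N) → False := by
  induction N with
  | zero =>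
    intro p hp _ hN
    have h1 := hN 0
    have h2 := mem_rectSet_inl.1 hp
    simp only [Function.iterate_zero, id, Nat.cast_zero] at h1
    omega
  | succ N ih =>
    intro p hp hroot hN
    set f := next mate with hf
    obtain ⟨i, j, hij, hfij⟩ : ∃ i j, i < j ∧ f^[i] p = f^[j] p := by
      have : ¬ Function.Injective fun k => f^[k] p := fun hinj =>
        Set.infinite_of_injective_forall_mem hinj (fun k => h.iterate_next_mem hp k)
          (finite_inl m n)
      simp only [Function.Injective, not_forall] at this
      obtain ⟨i, j, hij, hne⟩ := this
      rcases lt_or_gt_of_ne hne with hlt | hlt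
      · exact ⟨i, j, hlt, hij⟩
      · exact ⟨j, i, hlt, hij.symm⟩
    set q := f^[i] p with hq
    obtain ⟨d, rfl⟩ : ∃ d, j = d + 1 + i := ⟨j - i - 1, by omega⟩
    have hper : f^[d + 1] q = q := by rw [hq, ← Function.iterate_add_apply]; exact hfij.symm
    have hqk : ∀ k, f^[k] q = f^[k + i] p := fun k => by rw [hq, ← Function.iterate_add_apply]
    let O : Set (ℤ × ℤ) := Set.range fun k => f^[k] q
    obtain ⟨ε, hε⟩ : ∃ ε, Par ε q := ⟨q.1 + q.2, by simp only [Par]; omega⟩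
    have hpark : ∀ k, Par ε (f^[k] q) := by
      intro k
      induction k with
      | zero => exact hε
      | succ k ihk => rw [Function.iterate_succ_apply']; exact par_next.2 ihk
    have hO : ∀ v ∈ O, Sum.inl v ∈ rectSet m n ∧ Par ε v ∧ f v ≠ v := by
      rintro _ ⟨k, rfl⟩
      refine ⟨?_, hpark k, ?_⟩
      · simp only [hqk]; exact h.iterate_next_mem hp _
      · simp only [hqk]; exact hroot _
    have hbij : Set.BijOn f O O := by
      refine ⟨?_, ?_, ?_⟩
      · rintro _ ⟨k, rfl⟩
        exact ⟨k + 1, Function.iterate_succ_apply' _ _ _⟩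
      · refine (Function.bijOn_periodicPts f).injOn.mono ?_
        rintro _ ⟨k, rfl⟩
        refine Function.mk_mem_periodicPts (Nat.succ_pos d) ?_
        exact (show Function.IsPeriodicPt f (d + 1) q from hper).apply_iterate k
      · rintro _ ⟨k, rfl⟩
        refine ⟨f^[k + d] q, ⟨k + d, rfl⟩, ?_⟩
        show f (f^[k + d] q) = f^[k] q
        rw [← Function.iterate_succ_apply' f, Nat.succ_eq_add_one, add_assoc,
          Function.iterate_add_apply, hper]
    obtain ⟨S, hS, hSb⟩ := exists_enclosed (m := m) (n := n) (ε := ε)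
      (e := fun z => if ∃ v ∈ O, mate (Sum.inl v) = Sum.inr z then 1 else 0)
      (by
        intro z hz
        obtain ⟨v, hv, hvz⟩ : ∃ v ∈ O, mate (Sum.inl v) = Sum.inr z := by
          by_contra hcon
          exact hz (if_neg hcon)
        exact (h.corner_of_inr (hO v hv).1 hvz).2.1)
      (h.orbit_faces_even hO hbij)
    have hSL : ∀ y ∈ S, Sum.inl y ∈ rectSet m n := fun y hy => by
      have := (hS y hy).2.1
      rw [mem_rectSet_inl]; omega
    have hSnext : ∀ y, Sum.inl y ∈ rectSet m n → Par (ε + 1) y → (y ∈ S ↔ f y ∈ S) := by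
      intro y hy hpy
      rcases hz : mate (Sum.inl y) with r | z
      · rw [hf, next_of_inl hz]
      · obtain ⟨hc, hzL, hzy⟩ := h.corner_of_inr hy hz
        rw [hf, next_of_inr hz, hSb z y hc hpy]
        refine if_neg ?_
        rintro ⟨v, hv, hvz⟩
        have := (h.corner_of_inr (hO v hv).1 hvz).2.2
        obtain rfl : y = v := Sum.inl.inj (hzy.symm.trans this)
        have := (hO y hv).2.1
        simp only [Par] at *; omega
    have hSroot := h.next_ne_of_enclosed m (ε + 1) S
      (fun y hy => ⟨(hS y hy).1, (hS y hy).2.1, (hS y hy).2.1.2.1⟩) hSnext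
    -- The face matched with `q` belongs to the cycle, so exactly one of its two corners of the
    -- other class is in `S`.
    obtain ⟨y, hy⟩ : ∃ y, y ∈ S := by
      rcases hz : mate (Sum.inl q) with r | z
      · exact absurd (next_of_inl hz) (hO q ⟨0, rfl⟩).2.2
      obtain ⟨hc, hzL, -⟩ := h.corner_of_inr (hO q ⟨0, rfl⟩).1 hz
      have hsz : Corner (q.1, 2 * z.2 + 1 - q.2) z := by simp only [Corner] at *; omega
      have hs := hSb z _ hsz (by simp only [Par, Corner] at *; omega)
      rw [if_pos ⟨q, ⟨0, rfl⟩, hz⟩] at hs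
      by_contra! hcon
      simp [hcon] at hs
    have horb : ∀ k, f^[k] y ∈ S := by
      intro k
      induction k with
      | zero => exact hy
      | succ k ihk =>
        rw [Function.iterate_succ_apply']
        exact (hSnext _ (hSL _ ihk) (hS _ ihk).1).1 ihk
    -- The ray from a point of `S` meets a face of the cycle. A corner of class `ε` of that face
    -- exceeds the point in coordinate sum by `2 * l + 1`, and it is bounded by the hypothesis on
    -- the orbit of `p`.
    refine ih y (hSL y hy) (fun k => hSroot _ (horb k)) fun k => ?_
    obtain ⟨hp1, -, l, hl, hle⟩ := hS _ (horb k)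
    obtain ⟨v, hv, hvz⟩ : ∃ v ∈ O, mate (Sum.inl v) =
        Sum.inr ((f^[k] y).1 + l, (f^[k] y).2 + l) := by
      by_contra hcon
      exact hle (if_neg hcon)
    have hc := (h.corner_of_inr (hO v hv).1 hvz).1
    have hpv := (hO v hv).2.1
    obtain ⟨k', rfl⟩ := hv
    have := hN (k' + i)
    rw [← hqk] at this
    simp only [Corner, Par] at hc hpv hp1
    push_cast at this
    omega

/-- Every lattice point of the rectangle flows to a point matched with a lattice point. -/
theorem next_terminates (h : Mating m n mate) {p : ℤ × ℤ} (hp : Sum.inl p ∈ rectSet m n) :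
    ∃ k, next mate ((next mate)^[k] p) = (next mate)^[k] p := by
  by_contra! hcon
  refine h.next_terminates_aux (m + n + 1) p hp hcon fun k => ?_
  have := mem_rectSet_inl.1 (h.iterate_next_mem hp k)
  push_cast; omega

end Mating
end RadialGraph

/-! ### Rooted forests as flows -/

namespace RadialGraph

/-- `f` maps each vertex of the forest `G` to its parent, and the root of each component to
itself. -/
structure IsFlow {V : Type*} (G : SimpleGraph V) (f : V → V) : Prop where
  adj_iff : ∀ x y, G.Adj x y ↔ x ≠ y ∧ (f x = y ∨ f y = x)
  terminates : ∀ x, ∃ k, f (f^[k] x) = f^[k] x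

namespace IsFlow
variable {V : Type*} {G : SimpleGraph V} {f g : V → V}

lemma adj (h : IsFlow G f) {x : V} (hx : f x ≠ x) : G.Adj x (f x) :=
  (h.adj_iff _ _).2 ⟨hx.symm, Or.inl rfl⟩

lemma reachable (h : IsFlow G f) (x : V) : G.Reachable x (f x) := by
  by_cases hx : f x = x
  · rw [hx]
  · exact (h.adj hx).reachable

lemma reachable_iterate (h : IsFlow G f) (x : V) (k : ℕ) : G.Reachable x (f^[k] x) := by
  induction k with
  | zero => exact .rfl
  | succ k ih => rw [Function.iterate_succ_apply']; exact ih.trans (h.reachable _)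

/-- A periodic point equals its own iterates of arbitrarily high order, which are fixed points by
termination. -/
lemma iterate_ne (h : IsFlow G f) {x : V} (hx : f x ≠ x) (k : ℕ) : f^[k + 1] x ≠ x := by
  intro hk
  have hper : ∀ l, f^[l * (k + 1)] x = x := by
    intro l
    rw [mul_comm]
    exact Function.IsPeriodicPt.mul_const (f := f) (show Function.IsPeriodicPt f (k + 1) x from hk) l
  obtain ⟨j, hj⟩ := h.terminates x
  have hfix : ∀ l, f^[l] (f^[j] x) = f^[j] x := fun l => Function.iterate_fixed hj l
  have h1 : f^[j * (k + 1)] x = f^[j] x := by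
    rw [show j * (k + 1) = j * k + j by ring, Function.iterate_add_apply, hfix]
  rw [hper] at h1
  rw [← h1] at hj
  exact hx hj

/-- Every edge from `x` to `f x` is a bridge: without it, no walk leaves the set of points that flow
through `x`, whereas `f x` does not flow back to `x`. -/
lemma isAcyclic (h : IsFlow G f) : G.IsAcyclic := by
  rw [SimpleGraph.isAcyclic_iff_forall_adj_isBridge]
  have key : ∀ x, f x ≠ x → G.IsBridge s(x, f x) := by
    intro x hx
    rw [SimpleGraph.isBridge_iff]
    rintro ⟨p⟩
    have hinv : ∀ u w (p : (G.deleteEdges {s(x, f x)}).Walk u w),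
        (∃ k, f^[k] u = x) → ∃ k, f^[k] w = x := by
      intro u w p
      induction p with
      | nil => exact id
      | cons hadj _ ih =>
        rename_i u v w
        rintro ⟨k, hk⟩
        apply ih
        rw [SimpleGraph.deleteEdges_adj, h.adj_iff] at hadj
        obtain ⟨⟨hne, huv | hvu⟩, hnot⟩ := hadj
        · rcases k with _ | k
          · simp only [Function.iterate_zero, id] at hk
            subst hk huv
            simp at hnot
          · exact ⟨k, by rwa [Function.iterate_succ_apply, huv] at hk⟩
        · exact ⟨k + 1, by rw [Function.iterate_succ_apply, hvu, hk]⟩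
    obtain ⟨k, hk⟩ := hinv _ _ p ⟨0, rfl⟩
    exact h.iterate_ne hx k (by rwa [Function.iterate_succ_apply])
  intro v w hvw
  obtain ⟨hne, rfl | rfl⟩ := (h.adj_iff _ _).1 hvw
  · exact key v hne.symm
  · rw [Sym2.eq_swap]; exact key w hne

/-- Flowing into a fixed point `x` is a property that passes along every edge, and a fixed point `y`
flows only to itself. -/
lemma eq_of_reachable (h : IsFlow G f) {x y : V} (hx : f x = x) (hy : f y = y)
    (hr : G.Reachable x y) : x = y := by
  obtain ⟨p⟩ := hr
  have hinv : ∀ u w (p : G.Walk u w), (∃ k, f^[k] u = x) → ∃ k, f^[k] w = x := by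
    intro u w p
    induction p with
    | nil => exact id
    | cons hadj _ ih =>
      rename_i u v w
      rintro ⟨k, hk⟩
      apply ih
      obtain ⟨hne, rfl | hvu⟩ := (h.adj_iff _ _).1 hadj
      · exact ⟨k, by rw [← Function.iterate_succ_apply, Function.iterate_succ_apply', hk, hx]⟩
      · exact ⟨k + 1, by rw [Function.iterate_succ_apply, hvu, hk]⟩
  obtain ⟨k, hk⟩ := hinv _ _ p ⟨0, rfl⟩
  rw [Function.iterate_fixed hy] at hk
  exact hk.symm

/-- Each component of the forest contains exactly one fixed point of the flow. -/
noncomputable def componentEquiv (h : IsFlow G f) : {x // f x = x} ≃ G.ConnectedComponent :=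
  Equiv.ofBijective (fun x => G.connectedComponentMk x.1) <| by
    constructor
    · rintro ⟨x, hx⟩ ⟨y, hy⟩ hxy
      exact Subtype.ext (h.eq_of_reachable hx hy (SimpleGraph.ConnectedComponent.exact hxy))
    · intro c
      induction c using SimpleGraph.ConnectedComponent.ind with
      | _ v =>
        obtain ⟨k, hk⟩ := h.terminates v
        exact ⟨⟨_, hk⟩, SimpleGraph.ConnectedComponent.sound (h.reachable_iterate v k).symm⟩

/-- A flow is determined by the forest and the roots. -/
lemma unique (hf : IsFlow G f) (hg : IsFlow G g) (hfix : ∀ x, f x = x ↔ g x = x) : f = g := by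
  -- The edge from `x` to `g x` must be used by `f` in the other direction. So a disagreement
  -- travels along `g` up to a root, where both maps agree.
  have step : ∀ x, f x ≠ g x → f (g x) ≠ g (g x) := by
    intro x hx
    have hgx : g x ≠ x := fun h => hx (by rw [h, hfix, h])
    obtain ⟨-, h1 | h1⟩ := (hf.adj_iff _ _).1 (hg.adj hgx)
    · exact absurd h1 hx
    · rw [h1]
      intro h2
      exact hg.iterate_ne hgx 1 h2.symm
  funext x
  by_contra hx
  have hall : ∀ k, f (g^[k] x) ≠ g (g^[k] x) := by
    intro k
    induction k with
    | zero => exact hx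
    | succ k ih => rw [Function.iterate_succ_apply']; exact step _ ih
  obtain ⟨k, hk⟩ := hg.terminates x
  exact hall k (by rw [hk, hfix, hk])

end IsFlow

/-- A forest with a chosen root in each component has a flow towards the roots. -/
theorem exists_isFlow {V : Type*} {G : SimpleGraph V} (hG : G.IsAcyclic)
    (ρ : G.ConnectedComponent → V) (hρ : ∀ c, G.connectedComponentMk (ρ c) = c) :
    ∃ f : V → V, IsFlow G f ∧ ∀ x, f x = x ↔ x = ρ (G.connectedComponentMk x) := by
  classical
  have hreach : ∀ x, G.Reachable x (ρ (G.connectedComponentMk x)) := fun x =>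
    SimpleGraph.ConnectedComponent.exact (hρ _).symm
  choose p hp using fun x => (hreach x).exists_isPath
  -- The flow takes the first step of the path to the root. At a root the path is trivial, and `snd`
  -- returns its only vertex.
  let f : V → V := fun x => (p x).snd
  have hroot : ∀ x, x = ρ (G.connectedComponentMk x) → f x = x := by
    intro x hx
    have key : ∀ y (q : G.Walk x y), q.IsPath → x = y → q.snd = x := by
      rintro y q hq rfl
      rw [(SimpleGraph.Walk.isPath_iff_nil.1 hq).eq_nil]; rfl
    exact key _ _ (hp x) hx
  have hnil : ∀ x, x ≠ ρ (G.connectedComponentMk x) → ¬ (p x).Nil := fun x hx hn => hx hn.eq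
  have hadj : ∀ x, x ≠ ρ (G.connectedComponentMk x) → G.Adj x (f x) := fun x hx =>
    (p x).adj_snd (hnil x hx)
  have hcomp : ∀ {x y}, G.Adj x y → G.connectedComponentMk x = G.connectedComponentMk y :=
    fun h => SimpleGraph.ConnectedComponent.sound h.reachable
  have hiff : ∀ x, f x = x ↔ x = ρ (G.connectedComponentMk x) := by
    refine fun x => ⟨fun h => ?_, hroot x⟩
    by_contra hx
    exact (hadj x hx).ne h.symm
  have hlen : ∀ x, x ≠ ρ (G.connectedComponentMk x) →
      (p (f x)).length + 1 = (p x).length := by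
    intro x hx
    have hc := hcomp (hadj x hx)
    -- The existential form permits rewriting the end of the path, since the root of `f x` equals
    -- that of `x` only propositionally.
    have htail : ∃ q : G.Walk (f x) (ρ (G.connectedComponentMk (f x))), q.IsPath ∧
        q.length + 1 = (p x).length := by
      rw [← hc]
      exact ⟨(p x).tail, (hp x).tail, (p x).length_tail_add_one (hnil x hx)⟩
    obtain ⟨q, hq, hql⟩ := htail
    have := congrArg Subtype.val ((hG.subsingleton_path _ _).elim ⟨q, hq⟩ ⟨p (f x), hp _⟩)
    simp only at this
    rw [← this, hql]
  refine ⟨f, ⟨?_, ?_⟩, hiff⟩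
  · intro x y
    constructor
    · intro h
      refine ⟨h.ne, ?_⟩
      by_cases hy : y ∈ (p x).support
      · exact Or.inl (hG.eq_snd_of_adj_start (hp x) h hy).symm
      · right
        have hq : ∃ q : G.Walk y (ρ (G.connectedComponentMk y)), q.IsPath ∧ q.snd = x := by
          rw [← hcomp h]
          exact ⟨.cons h.symm (p x), (hp x).cons hy, by simp⟩
        obtain ⟨q, hq, hqx⟩ := hq
        have := congrArg Subtype.val ((hG.subsingleton_path _ _).elim ⟨q, hq⟩ ⟨p y, hp _⟩)
        simp only at this
        show (p y).snd = x
        rw [← this, hqx]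
    · have key : ∀ x y, x ≠ y → f x = y → G.Adj x y := by
        rintro x _ hne rfl
        exact hadj x fun h => hne (hroot x h).symm
      rintro ⟨hne, h | h⟩
      · exact key x y hne h
      · exact (key y x hne.symm h).symm
  · intro x
    induction hl : (p x).length using Nat.strong_induction_on generalizing x with
    | _ l ih =>
      by_cases hx : x = ρ (G.connectedComponentMk x)
      · exact ⟨0, hroot x hx⟩
      · obtain ⟨k, hk⟩ := ih _ (by have := hlen x hx; omega) (f x) rfl
        exact ⟨k + 1, by rwa [Function.iterate_succ_apply]⟩

end RadialGraph

/-! ### Vertex classes, middle vertices and vertex counts -/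

namespace RadialGraph
variable {m n : ℕ}

/-- `W` is the set of the lattice points of class `ε` in the rectangle. -/
def IsClass (ε : ℤ) (W : Set (rectSet m n)) : Prop :=
  ∀ v, v ∈ W ↔ ∃ p, v.1 = Sum.inl p ∧ Par ε p

lemma isClass_V₁ : IsClass 0 (V₁ m n) := by
  intro v
  constructor
  · rintro ⟨x, y, h, hp⟩
    exact ⟨(x, y), h, by rw [Int.even_iff] at hp; simp only [Par]; omega⟩
  · rintro ⟨⟨x, y⟩, h, hp⟩
    exact ⟨x, y, h, by rw [Int.even_iff]; simp only [Par] at hp; omega⟩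

lemma isClass_V₂ : IsClass 1 (V₂ m n) := by
  intro v
  constructor
  · rintro ⟨x, y, h, hp⟩
    exact ⟨(x, y), h, by rw [Int.odd_iff] at hp; simp only [Par]; omega⟩
  · rintro ⟨⟨x, y⟩, h, hp⟩
    exact ⟨x, y, h, by rw [Int.odd_iff]; simp only [Par] at hp; omega⟩

lemma mem_V₃_iff {v : rectSet m n} : v ∈ V₃ m n ↔ ∃ z, v.1 = Sum.inr z :=
  ⟨fun ⟨x, y, h⟩ => ⟨(x, y), h⟩, fun ⟨⟨x, y⟩, h⟩ => ⟨x, y, h⟩⟩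

lemma mem_lattice_iff {v : rectSet m n} : v ∈ V₁ m n ∪ V₂ m n ↔ ∃ p, v.1 = Sum.inl p := by
  rw [Set.mem_union, isClass_V₁, isClass_V₂]
  constructor
  · rintro (⟨p, h, -⟩ | ⟨p, h, -⟩) <;> exact ⟨p, h⟩
  · rintro ⟨p, h⟩
    by_cases hp : Par 0 p
    · exact Or.inl ⟨p, h, hp⟩
    · exact Or.inr ⟨p, h, by simp only [Par] at *; omega⟩

lemma notMem_V₃_iff {v : rectSet m n} : v ∉ V₃ m n ↔ v ∈ V₁ m n ∪ V₂ m n := by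
  rw [mem_V₃_iff, mem_lattice_iff]
  rcases v.1 with p | z <;> simp

lemma IsClass.notMem_V₃ {ε : ℤ} {W : Set (rectSet m n)} (hW : IsClass ε W) {v : rectSet m n}
    (hv : v ∈ W) : v ∉ V₃ m n := by
  rw [mem_V₃_iff]
  rintro ⟨z, hz⟩
  obtain ⟨p, hp, -⟩ := (hW v).1 hv
  rw [hz] at hp; cases hp

lemma notMem_V₂_of_mem_V₁ {v : rectSet m n} (h : v ∈ V₁ m n) : v ∉ V₂ m n := by
  intro h'
  obtain ⟨p, hp, pp⟩ := (isClass_V₁ v).1 h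
  obtain ⟨q, hq, pq⟩ := (isClass_V₂ v).1 h'
  rw [hp] at hq
  obtain rfl := Sum.inl.inj hq
  simp only [Par] at *; omega

lemma adj_iff {v w : rectSet m n} : (rect m n).Adj v w ↔ adj v.1 w.1 := Iff.rfl

lemma notMem_V₃_of_adj {v w : rectSet m n} (h : (rect m n).Adj v w) (hv : v ∈ V₃ m n) :
    w ∉ V₃ m n := by
  rw [adj_iff] at h
  rw [mem_V₃_iff] at *
  rintro ⟨z', hz'⟩
  obtain ⟨z, hz⟩ := hv
  rw [hz, hz'] at h
  exact h

lemma par_of_adj {p q : ℤ × ℤ} (h : (p.1 - q.1) ^ 2 + (p.2 - q.2) ^ 2 = 1) :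
    (p.1 + p.2 + (q.1 + q.2)) % 2 = 1 := by
  have h1 : Odd ((p.1 - q.1) ^ 2 + (p.2 - q.2) ^ 2) := h ▸ odd_one
  rw [Int.odd_add, Int.odd_pow' two_ne_zero, Int.even_pow' two_ne_zero] at h1
  rw [Int.odd_iff, Int.even_iff] at h1
  omega

lemma mem_V₂_of_adj {v w : rectSet m n} (h : (rect m n).Adj v w) (hv : v ∈ V₁ m n)
    (hw : w ∉ V₃ m n) : w ∈ V₂ m n := by
  rw [notMem_V₃_iff, mem_lattice_iff] at hw
  obtain ⟨q, hq⟩ := hw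
  obtain ⟨p, hp, pp⟩ := (isClass_V₁ v).1 hv
  rw [adj_iff, hp, hq] at h
  have := par_of_adj h
  exact (isClass_V₂ w).2 ⟨q, hq, by simp only [Par] at *; omega⟩

lemma mem_V₁_of_adj {v w : rectSet m n} (h : (rect m n).Adj v w) (hv : v ∈ V₂ m n)
    (hw : w ∉ V₃ m n) : w ∈ V₁ m n := by
  rw [notMem_V₃_iff] at hw
  refine hw.resolve_right fun hw' => ?_
  obtain ⟨q, hq, pq⟩ := (isClass_V₂ w).1 hw'
  obtain ⟨p, hp, pp⟩ := (isClass_V₂ v).1 hv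
  rw [adj_iff, hp, hq] at h
  have := par_of_adj h
  simp only [Par] at *; omega

lemma IsMiddle.symm {z x y : rectSet m n} (h : IsMiddle z x y) : IsMiddle z y x :=
  ⟨h.1, h.2.2.symm, h.2.1.symm⟩

lemma IsClass.isMiddle_iff {ε : ℤ} {W : Set (rectSet m n)} (hW : IsClass ε W) {z x y : rectSet m n}
    (hx : x ∈ W) (hy : y ∈ W) (hne : x ≠ y) : IsMiddle z x y ↔
    ∃ c p, z.1 = Sum.inr c ∧ x.1 = Sum.inl p ∧ y.1 = Sum.inl (opp c p) ∧ Corner p c := by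
  obtain ⟨p, hp, pp⟩ := (hW x).1 hx
  obtain ⟨q, hq, pq⟩ := (hW y).1 hy
  constructor
  · rintro ⟨hz, h1, h2⟩
    obtain ⟨c, hc⟩ := mem_V₃_iff.1 hz
    rw [adj_iff, hp, hc] at h1
    rw [adj_iff, hq, hc] at h2
    refine ⟨c, p, hc, hp, ?_, h1⟩
    rcases eq_or_eq_opp h2 h1 pq pp with rfl | rfl
    · exact absurd (Subtype.ext (hp.trans hq.symm)) hne
    · exact hq
  · rintro ⟨c, p', hc, hp', hq', hcor⟩
    refine ⟨mem_V₃_iff.2 ⟨c, hc⟩, ?_, ?_⟩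
    · rw [adj_iff, hp', hc]; exact hcor
    · rw [adj_iff, hq', hc]; exact corner_opp hcor

lemma IsClass.middle_unique {ε : ℤ} {W : Set (rectSet m n)} (hW : IsClass ε W)
    {z z' x y : rectSet m n} (hx : x ∈ W) (hy : y ∈ W) (hne : x ≠ y) (h : IsMiddle z x y)
    (h' : IsMiddle z' x y) : z = z' := by
  obtain ⟨c, p, hc, hp, hq, -⟩ := (hW.isMiddle_iff hx hy hne).1 h
  obtain ⟨c', p', hc', hp', hq', -⟩ := (hW.isMiddle_iff hx hy hne).1 h'
  rw [hp] at hp'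
  obtain rfl := Sum.inl.inj hp'
  rw [hq] at hq'
  have := Sum.inl.inj hq'
  apply Subtype.ext
  rw [hc, hc']
  simp only [opp, Prod.mk.injEq] at this
  congr 1
  ext <;> omega

lemma IsClass.end_unique {ε : ℤ} {W : Set (rectSet m n)} (hW : IsClass ε W)
    {z x y y' : rectSet m n} (hx : x ∈ W) (hy : y ∈ W) (hy' : y' ∈ W) (hne : x ≠ y)
    (hne' : x ≠ y') (h : IsMiddle z x y) (h' : IsMiddle z x y') : y = y' := by
  obtain ⟨c, p, hc, hp, hq, -⟩ := (hW.isMiddle_iff hx hy hne).1 h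
  obtain ⟨c', p', hc', hp', hq', -⟩ := (hW.isMiddle_iff hx hy' hne').1 h'
  rw [hp] at hp'
  obtain rfl := Sum.inl.inj hp'
  rw [hc] at hc'
  obtain rfl := Sum.inr.inj hc'
  exact Subtype.ext (hq.trans hq'.symm)

/-- If `z` is a middle vertex of two pairs of points of one class, the pairs are equal. -/
lemma IsClass.start_eq_or {ε : ℤ} {W : Set (rectSet m n)} (hW : IsClass ε W)
    {z x y x' y' : rectSet m n} (hx : x ∈ W) (hy : y ∈ W) (hx' : x' ∈ W)
    (hne : x ≠ y) (h : IsMiddle z x y) (h' : IsMiddle z x' y') :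
    x' = x ∨ x' = y := by
  by_cases hxx : x = x'
  · exact Or.inl hxx.symm
  · exact Or.inr (hW.end_unique hx hx' hy hxx hne ⟨h.1, h.2.1, h'.2.1.symm⟩ h)

instance : Finite (rectSet m n) := by
  have h : (rectSet m n).Finite := by
    refine (((finite_inl m n).image Sum.inl).union ((finite_inr m n).image Sum.inr)).subset ?_
    rintro (p | z) hv
    · exact Or.inl ⟨p, hv, rfl⟩
    · exact Or.inr ⟨z, hv, rfl⟩
  exact h.to_subtype

lemma ncard_V₃ : (V₃ m n).ncard = m * n := by
  rw [← Set.ncard_image_of_injective _ Subtype.val_injective]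
  have : (Subtype.val '' V₃ m n : Set Vertex) = Sum.inr ''
      ((Finset.Ico (0 : ℤ) m ×ˢ Finset.Ico (0 : ℤ) n : Finset (ℤ × ℤ)) : Set (ℤ × ℤ)) := by
    ext v
    constructor
    · rintro ⟨v, hv, rfl⟩
      obtain ⟨z, hz⟩ := mem_V₃_iff.1 hv
      refine ⟨z, ?_, hz.symm⟩
      have := mem_rectSet_inr.1 (hz ▸ v.2)
      simpa using this
    · rintro ⟨z, hz, rfl⟩
      exact ⟨⟨Sum.inr z, mem_rectSet_inr.2 (by simpa using hz)⟩, mem_V₃_iff.2 ⟨z, rfl⟩, rfl⟩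
  rw [this, Set.ncard_image_of_injective _ Sum.inr_injective, Set.ncard_coe_finset]
  simp

lemma ncard_lattice : (V₁ m n ∪ V₂ m n).ncard = (m + 1) * (n + 1) := by
  rw [← Set.ncard_image_of_injective _ Subtype.val_injective]
  have : (Subtype.val '' (V₁ m n ∪ V₂ m n) : Set Vertex) = Sum.inl ''
      ((Finset.Icc (0 : ℤ) m ×ˢ Finset.Icc (0 : ℤ) n : Finset (ℤ × ℤ)) : Set (ℤ × ℤ)) := by
    ext v
    constructor
    · rintro ⟨v, hv, rfl⟩
      obtain ⟨z, hz⟩ := mem_lattice_iff.1 hv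
      refine ⟨z, ?_, hz.symm⟩
      have := mem_rectSet_inl.1 (hz ▸ v.2)
      simp [Prod.le_def]; omega
    · rintro ⟨z, hz, rfl⟩
      exact ⟨⟨Sum.inl z, mem_rectSet_inl.2 (by simp [Prod.le_def] at hz; omega)⟩, mem_lattice_iff.2 ⟨z, rfl⟩, rfl⟩
  rw [this, Set.ncard_image_of_injective _ Sum.inl_injective, Set.ncard_coe_finset]
  simp

/-- The map `f` on `W` sends each point that `M` matches with a face centre to the opposite corner
of that face, and fixes all other points. -/
def Compat (M : Set (Sym2 (rectSet m n))) (W : Set (rectSet m n)) (f : W → W) : Prop :=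
  ∀ (x : W), ∀ z ∈ V₃ m n, s(x.1, z) ∈ M ↔ f x ≠ x ∧ IsMiddle z x.1 (f x).1

/-- The graph on `W` formed by the edges with a middle vertex that is matched to an end. -/
def matchedGraph (M : Set (Sym2 (rectSet m n))) (W : Set (rectSet m n)) : SimpleGraph W where
  Adj x y := (middleGraph W).Adj x y ∧ MatchedMiddle M x.1 y.1
  symm := ⟨by
    rintro x y ⟨h, z, hz, h1⟩
    refine ⟨h.symm, z, hz.symm, ?_⟩
    exact h1.symm.imp (by rw [Sym2.eq_swap]; exact id) (by rw [Sym2.eq_swap]; exact id)⟩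
  loopless := ⟨fun _ h => h.1.ne rfl⟩

/-- Stated for an arbitrary edge set `M`, so that it serves both for a given covering and for the
edge set built from a pair of forests. -/
lemma Compat.adj_iff {ε : ℤ} {M : Set (Sym2 (rectSet m n))} {W : Set (rectSet m n)} {f : W → W}
    (hc : Compat M W f) (hW : IsClass ε W) (hmid : ∀ x, f x ≠ x → ∃ z, IsMiddle z x.1 (f x).1)
    (x y : W) : (matchedGraph M W).Adj x y ↔ x ≠ y ∧ (f x = y ∨ f y = x) := by
  have fwd : ∀ x y : W, x ≠ y → ∀ z, IsMiddle z x.1 y.1 → s(x.1, z) ∈ M → f x = y := by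
    intro x y hne z hz hM
    obtain ⟨hx, hm⟩ := (hc x z hz.1).1 hM
    exact Subtype.ext (hW.end_unique x.2 (f x).2 y.2 (fun h => hx (Subtype.ext h.symm))
      (fun h => hne (Subtype.ext h)) hm hz)
  have bwd : ∀ x y : W, x ≠ y → f x = y → (matchedGraph M W).Adj x y := by
    rintro x _ hne rfl
    obtain ⟨z, hz⟩ := hmid x hne.symm
    exact ⟨⟨hne, z, hz⟩, z, hz, Or.inl ((hc x z hz.1).2 ⟨hne.symm, hz⟩)⟩
  constructor
  · rintro ⟨⟨hne, -⟩, z, hz, h1 | h1⟩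
    · exact ⟨hne, Or.inl (fwd x y hne z hz h1)⟩
    · exact ⟨hne, Or.inr (fwd y x hne.symm z hz.symm (by rwa [Sym2.eq_swap]))⟩
  · rintro ⟨hne, h | h⟩
    · exact bwd x y hne h
    · exact (bwd y x hne.symm h).symm

/-! ### Mates, flows and roots of a dimer covering -/

namespace DimerCovering

section General
variable {V : Type*} {G : SimpleGraph V} (M : DimerCovering G)

lemma existsUnique_mate (v : V) : ∃ w, ∀ u, s(v, u) ∈ M.1 ↔ u = w := by
  obtain ⟨e, ⟨he, hv⟩, huniq⟩ := M.2.2 v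
  obtain ⟨w, rfl⟩ := hv
  refine ⟨w, fun u => ⟨fun hu => ?_, fun hu => hu ▸ he⟩⟩
  exact Sym2.congr_right.1 (huniq _ ⟨hu, Sym2.mem_mk_left _ _⟩)

/-- The vertex with which `v` is matched. -/
noncomputable def mate (v : V) : V := (M.existsUnique_mate v).choose

lemma mem_iff {v w : V} : s(v, w) ∈ M.1 ↔ w = M.mate v := (M.existsUnique_mate v).choose_spec w

lemma mk_mate_mem (v : V) : s(v, M.mate v) ∈ M.1 := M.mem_iff.2 rfl

lemma adj_mate (v : V) : G.Adj v (M.mate v) := M.2.1 (M.mk_mate_mem v)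

lemma mate_mate (v : V) : M.mate (M.mate v) = v := by
  symm
  rw [← M.mem_iff, Sym2.eq_swap]
  exact M.mk_mate_mem v

lemma mate_eq_comm {v w : V} : M.mate v = w ↔ M.mate w = v := by
  constructor <;> rintro rfl <;> exact M.mate_mate _

lemma ext_mate {M M' : DimerCovering G} (h : ∀ v, M.mate v = M'.mate v) : M = M' := by
  apply Subtype.ext
  ext e
  induction e using Sym2.ind with
  | _ v w => rw [M.mem_iff, M'.mem_iff, h]

end General

variable (M : DimerCovering (rect m n))

open Classical in
/-- The matching as a map on all vertices of the radial graph. -/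
noncomputable def mateFun (v : Vertex) : Vertex :=
  if h : v ∈ rectSet m n then (M.mate ⟨v, h⟩).1 else v

lemma mateFun_coe (v : rectSet m n) : M.mateFun v.1 = (M.mate v).1 := by
  rw [mateFun, dif_pos v.2]

lemma mating : Mating m n M.mateFun where
  mem v hv := by
    rw [M.mateFun_coe ⟨v, hv⟩]; exact (M.mate _).2
  adj v hv := by
    rw [M.mateFun_coe ⟨v, hv⟩]; exact M.adj_mate ⟨v, hv⟩
  invol v hv := by
    rw [M.mateFun_coe ⟨v, hv⟩, M.mateFun_coe, M.mate_mate]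

lemma exists_flow {ε : ℤ} {W : Set (rectSet m n)} (hW : IsClass ε W) :
    ∃ f : W → W, IsFlow (matchedGraph M.1 W) f ∧ Compat M.1 W f ∧
      ∀ x, f x = x ↔ M.mate x.1 ∉ V₃ m n := by
  choose p hp pp using fun x : W => (hW x.1).1 x.2
  have hpm : ∀ x : W, Sum.inl (p x) ∈ rectSet m n := fun x => hp x ▸ x.1.2
  have hex : ∀ x : W, ∃ y : W, p y = next M.mateFun (p x) := by
    intro x
    have hm := M.mating.next_mem (hpm x)
    let y : W := ⟨⟨_, hm⟩, (hW _).2 ⟨_, rfl, par_next.2 (pp x)⟩⟩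
    exact ⟨y, (Sum.inl.inj (hp y)).symm⟩
  choose f hf using hex
  have hpinj : ∀ x y, p x = p y → x = y := fun x y h =>
    Subtype.ext (Subtype.ext ((hp x).trans ((congrArg Sum.inl h).trans (hp y).symm)))
  have hfix : ∀ x, f x = x ↔ M.mate x.1 ∉ V₃ m n := by
    intro x
    have h1 : f x = x ↔ next M.mateFun (p x) = p x := by
      rw [← hf]
      exact ⟨fun h => by rw [h], hpinj _ _⟩
    rw [h1, next_eq_self_iff, ← hp, mateFun_coe, notMem_V₃_iff, mem_lattice_iff]
  have hcompat : Compat M.1 W f := by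
    intro x z hz
    rw [M.mem_iff]
    have hmid : f x ≠ x → IsMiddle (M.mate x.1) x.1 (f x).1 := by
      intro hx
      rw [hW.isMiddle_iff x.2 (f x).2 (fun h => hx (Subtype.ext h.symm))]
      have h1 : M.mate x.1 ∈ V₃ m n := by
        by_contra h1
        exact hx ((hfix x).2 h1)
      obtain ⟨c, hc⟩ := mem_V₃_iff.1 h1
      have hc' : M.mateFun (Sum.inl (p x)) = Sum.inr c := by
        rw [← hp, mateFun_coe, hc]
      refine ⟨c, p x, hc, hp x, ?_, (M.mating.corner_of_inr (hpm x) hc').1⟩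
      rw [hp, hf, next_of_inr hc']
    constructor
    · rintro rfl
      have hx : f x ≠ x := fun h => (hfix x).1 h hz
      exact ⟨hx, hmid hx⟩
    · rintro ⟨hx, h1⟩
      exact hW.middle_unique x.2 (f x).2 (fun h => hx (Subtype.ext h.symm)) h1 (hmid hx)
  have hmid : ∀ x, f x ≠ x → ∃ z, IsMiddle z x.1 (f x).1 := by
    intro x hx
    have h1 : M.mate x.1 ∈ V₃ m n := by
      by_contra h1
      exact hx ((hfix x).2 h1)
    exact ⟨_, ((hcompat x _ h1).1 (M.mk_mate_mem _)).2⟩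
  refine ⟨f, ⟨hcompat.adj_iff hW hmid, fun x => ?_⟩, hcompat, hfix⟩
  obtain ⟨k, hk⟩ := M.mating.next_terminates (hpm x)
  have hpk : ∀ k, p (f^[k] x) = (next M.mateFun)^[k] (p x) := by
    intro k
    induction k with
    | zero => rfl
    | succ k ih => rw [Function.iterate_succ_apply', Function.iterate_succ_apply', hf, ih]
  exact ⟨k, hpinj _ _ (by rw [hf, hpk, hk])⟩

/-- The points of `W` that are matched with a lattice point. -/
def roots (W : Set (rectSet m n)) : Set (rectSet m n) := {v | v ∈ W ∧ M.mate v ∉ V₃ m n}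

lemma mate_mem_roots₂ {v : rectSet m n} (hv : v ∈ M.roots (V₁ m n)) :
    M.mate v ∈ M.roots (V₂ m n) :=
  ⟨mem_V₂_of_adj (M.adj_mate v) hv.1 hv.2, by
    rw [M.mate_mate]; exact isClass_V₁.notMem_V₃ hv.1⟩

lemma mate_mem_roots₁ {v : rectSet m n} (hv : v ∈ M.roots (V₂ m n)) :
    M.mate v ∈ M.roots (V₁ m n) :=
  ⟨mem_V₁_of_adj (M.adj_mate v) hv.1 hv.2, by
    rw [M.mate_mate]; exact isClass_V₂.notMem_V₃ hv.1⟩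

lemma mate_injective : Function.Injective M.mate :=
  Function.LeftInverse.injective M.mate_mate

lemma image_roots : M.mate '' M.roots (V₁ m n) = M.roots (V₂ m n) := by
  ext v
  constructor
  · rintro ⟨w, hw, rfl⟩; exact M.mate_mem_roots₂ hw
  · intro hv; exact ⟨_, M.mate_mem_roots₁ hv, M.mate_mate v⟩

lemma ncard_roots₂ : (M.roots (V₂ m n)).ncard = (M.roots (V₁ m n)).ncard := by
  rw [← image_roots, Set.ncard_image_of_injective _ M.mate_injective]

/-- The lattice points are the roots and the mates of the face centres, so there are `(m + 1) * (n +
1) - m * n` roots; `mate` exchanges the two classes of roots. -/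
lemma ncard_roots₁ : (M.roots (V₁ m n)).ncard = (m + n + 1) / 2 := by
  have hunion : V₁ m n ∪ V₂ m n = (M.roots (V₁ m n) ∪ M.roots (V₂ m n)) ∪ M.mate '' V₃ m n := by
    ext v
    constructor
    · intro hv
      by_cases h : M.mate v ∈ V₃ m n
      · exact Or.inr ⟨_, h, M.mate_mate v⟩
      · exact Or.inl (hv.imp (fun h1 => ⟨h1, h⟩) fun h1 => ⟨h1, h⟩)
    · rintro ((h | h) | ⟨z, hz, rfl⟩)
      · exact Or.inl h.1
      · exact Or.inr h.1
      · rw [← notMem_V₃_iff]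
        exact notMem_V₃_of_adj (M.adj_mate z) hz
  have hd1 : Disjoint (M.roots (V₁ m n)) (M.roots (V₂ m n)) := by
    rw [Set.disjoint_left]
    exact fun v h h' => notMem_V₂_of_mem_V₁ h.1 h'.1
  have hd2 : Disjoint (M.roots (V₁ m n) ∪ M.roots (V₂ m n)) (M.mate '' V₃ m n) := by
    rw [Set.disjoint_left]
    rintro v h ⟨z, hz, rfl⟩
    have : M.mate (M.mate z) ∉ V₃ m n := h.elim (fun h => h.2) fun h => h.2
    rw [M.mate_mate] at this
    exact this hz
  have h1 := ncard_lattice (m := m) (n := n)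
  rw [hunion, Set.ncard_union_eq hd2, Set.ncard_union_eq hd1, ncard_roots₂,
    Set.ncard_image_of_injective _ M.mate_injective, ncard_V₃] at h1
  have : (m + 1) * (n + 1) = m * n + (m + n + 1) := by ring
  omega

lemma inter_E₂ : M.1 ∩ E₂ m n = (fun v => s(v, M.mate v)) '' M.roots (V₁ m n) := by
  ext e
  constructor
  · induction e using Sym2.ind with
    | _ v w =>
      rintro ⟨hM, hadj, hmem⟩
      have hv := hmem v (Sym2.mem_mk_left _ _)
      have hw := hmem w (Sym2.mem_mk_right _ _)
      have hw' := M.mem_iff.1 hM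
      have hv' := M.mem_iff.1 (Sym2.eq_swap ▸ hM)
      rw [← notMem_V₃_iff] at hw
      rcases hv with hv | hv
      · exact ⟨v, ⟨hv, hw' ▸ hw⟩, by rw [hw']⟩
      · refine ⟨w, ⟨mem_V₁_of_adj hadj hv hw, ?_⟩, by simp only [← hv']; exact Sym2.eq_swap⟩
        rw [← hv']; exact isClass_V₂.notMem_V₃ hv
  · rintro ⟨v, hv, rfl⟩
    refine ⟨M.mk_mate_mem v, M.adj_mate v, fun u hu => ?_⟩
    rcases Sym2.mem_iff.1 hu with rfl | rfl
    · exact Or.inl hv.1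
    · exact Or.inr (M.mate_mem_roots₂ hv).1

lemma ncard_inter_E₂ : (M.1 ∩ E₂ m n).ncard = (m + n + 1) / 2 := by
  rw [inter_E₂, Set.InjOn.ncard_image, ncard_roots₁]
  intro v hv w hw h
  rcases Sym2.eq_iff.1 h with ⟨h, -⟩ | ⟨h, -⟩
  · exact h
  · subst h
    exact absurd (M.mate_mem_roots₂ hw).1 (notMem_V₂_of_mem_V₁ hv.1)

end DimerCovering
end RadialGraph

/-! ### From coverings to paired forests, injectively -/

namespace RadialGraph
variable {m n : ℕ}

namespace DimerCovering
variable (M : DimerCovering (rect m n))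

lemma matchedGraph_isSpanningForest {ε : ℤ} {W : Set (rectSet m n)} (hW : IsClass ε W) :
    IsSpanningForest (middleGraph W) (matchedGraph M.1 W) (M.roots W).ncard := by
  obtain ⟨f, hf, -, hfix⟩ := M.exists_flow hW
  refine ⟨fun _ _ h => h.1, hf.isAcyclic, ?_⟩
  rw [← Nat.card_congr hf.componentEquiv, ← Nat.card_coe_set_eq]
  exact Nat.card_congr
    { toFun := fun x => ⟨x.1.1, x.1.2, (hfix _).1 x.2⟩
      invFun := fun v => ⟨⟨v.1, v.2.1⟩, (hfix _).2 v.2.2⟩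
      left_inv := fun _ => rfl
      right_inv := fun _ => rfl }

/-- The middle vertex of a forest edge is matched to an end of that edge, and its only mate cannot
lie in both classes. -/
lemma noIntersection :
    NoIntersection (matchedGraph M.1 (V₁ m n)) (matchedGraph M.1 (V₂ m n)) := by
  have key : ∀ {ε : ℤ} {W : Set (rectSet m n)}, IsClass ε W → ∀ {x y : W} {z : rectSet m n},
      (matchedGraph M.1 W).Adj x y → IsMiddle z x.1 y.1 → M.mate z ∈ W := by
    rintro ε W hW x y z ⟨hadj, z', hz', h⟩ hz
    obtain rfl := hW.middle_unique x.2 y.2 (fun h => hadj.ne (Subtype.ext h)) hz hz'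
    rcases h with h | h
    · rw [Sym2.eq_swap, M.mem_iff] at h
      exact h ▸ x.2
    · rw [M.mem_iff] at h
      exact h ▸ y.2
  intro x x' y y' z hx hy hz hz'
  exact notMem_V₂_of_mem_V₁ (key isClass_V₁ hx hz) (key isClass_V₂ hy hz')

lemma exists_root {ε : ℤ} {W : Set (rectSet m n)} (hW : IsClass ε W) :
    ∃ ρ : (matchedGraph M.1 W).ConnectedComponent ≃ {v // v ∈ M.roots W},
      ∀ c v, (v.1 ∈ M.roots W ∧ (matchedGraph M.1 W).connectedComponentMk v = c) ↔
        v.1 = (ρ c).1 := by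
  obtain ⟨f, hf, -, hfix⟩ := M.exists_flow hW
  let e : {x // f x = x} ≃ {v // v ∈ M.roots W} :=
    { toFun := fun x => ⟨x.1.1, x.1.2, (hfix _).1 x.2⟩
      invFun := fun v => ⟨⟨v.1, v.2.1⟩, (hfix _).2 v.2.2⟩
      left_inv := fun _ => rfl
      right_inv := fun _ => rfl }
  refine ⟨hf.componentEquiv.symm.trans e, fun c v => ?_⟩
  have hc : ∃ x, hf.componentEquiv x = c := hf.componentEquiv.surjective c
  obtain ⟨x, rfl⟩ := hc
  rw [Equiv.trans_apply, Equiv.symm_apply_apply]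
  constructor
  · rintro ⟨hv, hvc⟩
    have : hf.componentEquiv ⟨v, (hfix v).2 hv.2⟩ = hf.componentEquiv x := hvc
    rw [← hf.componentEquiv.injective this]
    rfl
  · intro h
    obtain rfl : v = x.1 := Subtype.ext h
    exact ⟨⟨x.1.2, (hfix _).1 x.2⟩, rfl⟩

lemma pairs :
    Pairs (M.1 ∩ E₂ m n) (matchedGraph M.1 (V₁ m n)) (matchedGraph M.1 (V₂ m n)) := by
  obtain ⟨ρ₁, h₁⟩ := M.exists_root isClass_V₁
  obtain ⟨ρ₂, h₂⟩ := M.exists_root isClass_V₂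
  let τ : {v // v ∈ M.roots (V₁ m n)} ≃ {v // v ∈ M.roots (V₂ m n)} :=
    { toFun := fun v => ⟨_, M.mate_mem_roots₂ v.2⟩
      invFun := fun v => ⟨_, M.mate_mem_roots₁ v.2⟩
      left_inv := fun v => Subtype.ext (M.mate_mate _)
      right_inv := fun v => Subtype.ext (M.mate_mate _) }
  have hj : ∀ c, Joins s((ρ₁ c).1, M.mate (ρ₁ c).1) c ((ρ₁.trans (τ.trans ρ₂.symm)) c) := by
    intro c
    refine ⟨⟨_, (ρ₁ c).2.1⟩, ⟨_, (τ (ρ₁ c)).2.1⟩, rfl, ((h₁ c _).2 rfl).2, ?_⟩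
    refine ((h₂ _ _).2 ?_).2
    simp
  refine ⟨ρ₁.trans (τ.trans ρ₂.symm), fun c => ⟨s((ρ₁ c).1, M.mate (ρ₁ c).1), ⟨?_, hj c⟩, ?_⟩, ?_⟩
  · rw [inter_E₂]
    exact ⟨_, (ρ₁ c).2, rfl⟩
  · rintro e ⟨he, x, y, rfl, hx, -⟩
    have hy : y.1 = M.mate x.1 := M.mem_iff.1 he.1
    have hxr : x.1 ∈ M.roots (V₁ m n) := ⟨x.2, hy ▸ isClass_V₂.notMem_V₃ y.2⟩
    rw [hy, (h₁ c x).1 ⟨hxr, hx⟩]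
  · rw [inter_E₂]
    rintro e ⟨v, hv, rfl⟩
    refine ⟨(matchedGraph M.1 _).connectedComponentMk ⟨v, hv.1⟩, ?_⟩
    have : v = _ := (h₁ _ ⟨v, hv.1⟩).1 ⟨hv, rfl⟩
    have hj' := hj ((matchedGraph M.1 _).connectedComponentMk ⟨v, hv.1⟩)
    rwa [← this] at hj'

/-- The pair of forests with impurities that belongs to a dimer covering. -/
def toPairedForests : PairedForests m n ((m + n + 1) / 2) where
  F₁ := matchedGraph M.1 (V₁ m n)
  F₂ := matchedGraph M.1 (V₂ m n)
  impurities := M.1 ∩ E₂ m n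
  forest₁ := M.ncard_roots₁ ▸ M.matchedGraph_isSpanningForest isClass_V₁
  forest₂ := M.ncard_roots₁ ▸ M.ncard_roots₂ ▸ M.matchedGraph_isSpanningForest isClass_V₂
  impurities_subset := Set.inter_subset_right
  impurities_ncard := M.ncard_inter_E₂
  noIntersection := M.noIntersection
  pairs := M.pairs

variable {M}

lemma mate_eq_of_root {M' : DimerCovering (rect m n)} (hI : M.1 ∩ E₂ m n = M'.1 ∩ E₂ m n)
    {v : rectSet m n} (hv : v ∈ V₁ m n ∪ V₂ m n) (hr : M.mate v ∉ V₃ m n) :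
    M'.mate v = M.mate v := by
  have : s(v, M.mate v) ∈ M.1 ∩ E₂ m n := by
    refine ⟨M.mk_mate_mem v, M.adj_mate v, fun u hu => ?_⟩
    rcases Sym2.mem_iff.1 hu with rfl | rfl
    · exact hv
    · rwa [notMem_V₃_iff] at hr
  rw [hI] at this
  exact (M'.mem_iff.1 this.1).symm

/-- The impurities fix the roots, the forest with its roots fixes the flow, and the flow fixes the
mate of every non-root as the middle vertex on the way to its image. -/
lemma mate_eq_of_class {M' : DimerCovering (rect m n)} (hI : M.1 ∩ E₂ m n = M'.1 ∩ E₂ m n)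
    {ε : ℤ} {W : Set (rectSet m n)} (hW : IsClass ε W)
    (hF : matchedGraph M.1 W = matchedGraph M'.1 W) {v : rectSet m n} (hv : v ∈ W) :
    M'.mate v = M.mate v := by
  obtain ⟨f, hf, hcf, hfix⟩ := M.exists_flow hW
  obtain ⟨g, hg, hcg, hgix⟩ := M'.exists_flow hW
  have hlat : ∀ {v}, v ∈ W → v ∈ V₁ m n ∪ V₂ m n := fun hv =>
    notMem_V₃_iff.1 (hW.notMem_V₃ hv)
  rw [← hF] at hg
  obtain rfl : f = g := hf.unique hg fun x => by
    rw [hfix, hgix]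
    constructor
    · intro h; rwa [mate_eq_of_root hI (hlat x.2) h]
    · intro h; rwa [mate_eq_of_root hI.symm (hlat x.2) h]
  by_cases hr : M.mate v ∈ V₃ m n
  · have h1 := (hcf ⟨v, hv⟩ _ hr).1 (M.mk_mate_mem v)
    exact (M'.mem_iff.1 ((hcg ⟨v, hv⟩ _ hr).2 h1)).symm
  · exact mate_eq_of_root hI (hlat hv) hr

lemma toPairedForests_injective :
    Function.Injective (toPairedForests : DimerCovering (rect m n) → _) := by
  intro M M' h
  have hI : M.1 ∩ E₂ m n = M'.1 ∩ E₂ m n := congrArg PairedForests.impurities h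
  have h1 : matchedGraph M.1 (V₁ m n) = matchedGraph M'.1 _ := congrArg PairedForests.F₁ h
  have h2 : matchedGraph M.1 (V₂ m n) = matchedGraph M'.1 _ := congrArg PairedForests.F₂ h
  have hlat : ∀ v, v ∈ V₁ m n ∪ V₂ m n → M'.mate v = M.mate v := by
    rintro v (hv | hv)
    · exact mate_eq_of_class hI isClass_V₁ h1 hv
    · exact mate_eq_of_class hI isClass_V₂ h2 hv
  refine ext_mate fun v => ?_
  by_cases hv : v ∈ V₃ m n
  · have h3 := hlat (M.mate v) (notMem_V₃_iff.1 (notMem_V₃_of_adj (M.adj_mate v) hv))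
    rw [M.mate_mate] at h3
    exact (M'.mate_eq_comm.1 h3).symm
  · exact (hlat v (notMem_V₃_iff.1 hv)).symm

end DimerCovering

/-! ### From paired forests back to coverings -/

namespace PairedForests
variable {k : ℕ} (T : PairedForests m n k)

/-- The impurities are the edges `s(x c, y c)`, where `x c` and `y c` represent the components of
the two forests. -/
lemma exists_roots : ∃ (x : T.F₁.ConnectedComponent → V₁ m n)
    (y : T.F₂.ConnectedComponent → V₂ m n) (σ : T.F₁.ConnectedComponent ≃ T.F₂.ConnectedComponent),
    (∀ c, T.F₁.connectedComponentMk (x c) = c) ∧ (∀ c, T.F₂.connectedComponentMk (y c) = c) ∧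
    T.impurities = Set.range fun c => s((x c).1, (y (σ c)).1) := by
  obtain ⟨σ, h1, h2⟩ := T.pairs
  choose e he hu using h1
  choose x y hxy hx hy using fun c => (he c).2
  refine ⟨x, fun c => y (σ.symm c), σ, hx, fun c => by rw [hy]; simp, ?_⟩
  ext e'
  simp only [Equiv.symm_apply_apply, ← hxy]
  constructor
  · intro h
    obtain ⟨c, hc⟩ := h2 e' h
    exact ⟨c, (hu c e' ⟨h, hc⟩).symm⟩
  · rintro ⟨c, rfl⟩
    exact (he c).1

/-- The ends of the impurities serve as roots. The covering consists of the impurities and, by the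
relation `Out`, of an edge from each non-root to the middle vertex on the way to its parent. -/
theorem exists_toPairedForests (hmn : Odd (m + n)) (T : PairedForests m n ((m + n + 1) / 2)) :
    ∃ M : DimerCovering (rect m n), M.toPairedForests = T := by
  obtain ⟨x, y, σ, hx, hy, hI⟩ := T.exists_roots
  obtain ⟨f, hf, hfix⟩ := exists_isFlow T.forest₁.2.1 x hx
  obtain ⟨g, hg, hgix⟩ := exists_isFlow T.forest₂.2.1 y hy
  have hfr : ∀ v, f v = v ↔ ∃ c, v = x c := fun v => by
    rw [hfix]
    exact ⟨fun h => ⟨_, h⟩, fun ⟨c, hc⟩ => by rw [hc, hx]⟩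
  have hgr : ∀ v, g v = v ↔ ∃ c, v = y c := fun v => by
    rw [hgix]
    exact ⟨fun h => ⟨_, h⟩, fun ⟨c, hc⟩ => by rw [hc, hy]⟩
  have hfm : ∀ v, f v ≠ v → ∃ z, IsMiddle z v.1 (f v).1 := fun v hv =>
    (T.forest₁.1 (hf.adj hv)).2
  have hgm : ∀ v, g v ≠ v → ∃ z, IsMiddle z v.1 (g v).1 := fun v hv =>
    (T.forest₂.1 (hg.adj hv)).2
  have xinj : Function.Injective x := Function.LeftInverse.injective hx
  have yinj : Function.Injective y := Function.LeftInverse.injective hy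
  let Out : rectSet m n → rectSet m n → Prop := fun v z =>
    (∃ w : V₁ m n, w.1 = v ∧ f w ≠ w ∧ IsMiddle z w.1 (f w).1) ∨
    (∃ w : V₂ m n, w.1 = v ∧ g w ≠ w ∧ IsMiddle z w.1 (g w).1)
  have out₁ : ∀ (w : V₁ m n) z, Out w.1 z ↔ f w ≠ w ∧ IsMiddle z w.1 (f w).1 := by
    intro w z
    refine ⟨?_, fun h => Or.inl ⟨w, rfl, h⟩⟩
    rintro (⟨w', h, h'⟩ | ⟨w', h, -⟩)
    · obtain rfl := Subtype.ext h; exact h'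
    · exact absurd (h ▸ w'.2) (notMem_V₂_of_mem_V₁ w.2)
  have out₂ : ∀ (w : V₂ m n) z, Out w.1 z ↔ g w ≠ w ∧ IsMiddle z w.1 (g w).1 := by
    intro w z
    refine ⟨?_, fun h => Or.inr ⟨w, rfl, h⟩⟩
    rintro (⟨w', h, -⟩ | ⟨w', h, h'⟩)
    · exact absurd w.2 (notMem_V₂_of_mem_V₁ (h ▸ w'.2))
    · obtain rfl := Subtype.ext h; exact h'
  have out_adj : ∀ v z, Out v z → (rect m n).Adj v z ∧ v ∉ V₃ m n ∧ z ∈ V₃ m n := by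
    rintro _ z (⟨w, rfl, -, h⟩ | ⟨w, rfl, -, h⟩)
    · exact ⟨h.2.1, isClass_V₁.notMem_V₃ w.2, h.1⟩
    · exact ⟨h.2.1, isClass_V₂.notMem_V₃ w.2, h.1⟩
  have neV : ∀ {W : Set (rectSet m n)} {a b : W}, a ≠ b → b.1 ≠ a.1 := fun h h' =>
    h (Subtype.ext h'.symm)
  have out_right : ∀ v z z', Out v z → Out v z' → z = z' := by
    rintro _ z z' (⟨w, rfl, hw, h⟩ | ⟨w, rfl, hw, h⟩) h'
    · exact isClass_V₁.middle_unique w.2 (f w).2 (neV hw) h ((out₁ _ _).1 h').2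
    · exact isClass_V₂.middle_unique w.2 (g w).2 (neV hw) h ((out₂ _ _).1 h').2
  have out_left : ∀ v v' z, Out v z → Out v' z → v = v' := by
    rintro _ _ z (⟨w, rfl, hw, h⟩ | ⟨w, rfl, hw, h⟩) (⟨w', rfl, hw', h'⟩ | ⟨w', rfl, hw', h'⟩)
    · by_contra hne
      have e1 := (isClass_V₁.start_eq_or w.2 (f w).2 w'.2 (neV hw) h h').resolve_left (Ne.symm hne)
      have e2 := (isClass_V₁.start_eq_or w'.2 (f w').2 w.2 (neV hw') h' h).resolve_left hne
      -- Two points of one class sharing a middle vertex would be each other's parents, a cycle of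
      -- length two.
      refine hf.iterate_ne hw 1 ?_
      show f (f w) = w
      rw [← Subtype.ext e1, ← Subtype.ext e2]
    · exact absurd h' (T.noIntersection _ _ _ _ z (hf.adj hw) (hg.adj hw') h)
    · exact absurd h (T.noIntersection _ _ _ _ z (hf.adj hw') (hg.adj hw) h')
    · by_contra hne
      have e1 := (isClass_V₂.start_eq_or w.2 (g w).2 w'.2 (neV hw) h h').resolve_left (Ne.symm hne)
      have e2 := (isClass_V₂.start_eq_or w'.2 (g w').2 w.2 (neV hw') h' h).resolve_left hne
      refine hg.iterate_ne hw 1 ?_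
      show g (g w) = w
      rw [← Subtype.ext e1, ← Subtype.ext e2]
  have root_or : ∀ v, v ∉ V₃ m n →
      (∃ z, Out v z) ∨ (∃ c, v = (x c).1) ∨ ∃ c, v = (y c).1 := by
    intro v hv
    rcases notMem_V₃_iff.1 hv with h | h
    · by_cases hr : f ⟨v, h⟩ = ⟨v, h⟩
      · obtain ⟨c, hc⟩ := (hfr _).1 hr
        exact Or.inr (Or.inl ⟨c, congrArg Subtype.val hc⟩)
      · obtain ⟨z, hz⟩ := hfm _ hr
        exact Or.inl ⟨z, (out₁ ⟨v, h⟩ z).2 ⟨hr, hz⟩⟩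
    · by_cases hr : g ⟨v, h⟩ = ⟨v, h⟩
      · obtain ⟨c, hc⟩ := (hgr _).1 hr
        exact Or.inr (Or.inr ⟨c, congrArg Subtype.val hc⟩)
      · obtain ⟨z, hz⟩ := hgm _ hr
        exact Or.inl ⟨z, (out₂ ⟨v, h⟩ z).2 ⟨hr, hz⟩⟩
  have not_out_x : ∀ c z, ¬ Out (x c).1 z := fun c z h =>
    ((out₁ _ _).1 h).1 ((hfr _).2 ⟨c, rfl⟩)
  have not_out_y : ∀ c z, ¬ Out (y c).1 z := fun c z h =>
    ((out₂ _ _).1 h).1 ((hgr _).2 ⟨c, rfl⟩)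
  -- every face centre is used, by counting
  have out_surj : ∀ z ∈ V₃ m n, ∃ v, Out v z := by
    let N : Set (rectSet m n) := {v | ∃ z, Out v z}
    let X : Set (rectSet m n) := Set.range fun c => (x c).1
    let Y : Set (rectSet m n) := Set.range fun c => (y c).1
    have hX : X.ncard = (m + n + 1) / 2 := by
      show (Set.range (Subtype.val ∘ x)).ncard = _
      rw [← Set.image_univ, Set.ncard_image_of_injective _ (Subtype.val_injective.comp xinj),
        Set.ncard_univ, T.forest₁.2.2]
    have hY : Y.ncard = (m + n + 1) / 2 := by
      show (Set.range (Subtype.val ∘ y)).ncard = _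
      rw [← Set.image_univ, Set.ncard_image_of_injective _ (Subtype.val_injective.comp yinj),
        Set.ncard_univ, T.forest₂.2.2]
    have hsub : V₁ m n ∪ V₂ m n ⊆ N ∪ (X ∪ Y) := by
      intro v hv
      rcases root_or v (notMem_V₃_iff.2 hv) with h | ⟨c, h⟩ | ⟨c, h⟩
      · exact Or.inl h
      · exact Or.inr (Or.inl ⟨c, h.symm⟩)
      · exact Or.inr (Or.inr ⟨c, h.symm⟩)
    have hle := Set.ncard_le_ncard hsub
    rw [ncard_lattice] at hle
    have h1 := Set.ncard_union_le N (X ∪ Y)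
    have h2 := Set.ncard_union_le X Y
    have h3 : (m + 1) * (n + 1) = m * n + (m + n + 1) := by ring
    have hN : (V₃ m n).ncard ≤ N.ncard := by
      rw [ncard_V₃]
      -- Oddness makes the two halves `(m + n + 1) / 2` add up to exactly `m + n + 1`, leaving at
      -- least `m * n` non-roots.
      obtain ⟨t, ht⟩ := hmn
      omega
    choose! o ho using fun v (hv : v ∈ N) => hv
    have himg : o '' N = V₃ m n := by
      refine Set.eq_of_subset_of_ncard_le ?_ ?_
      · rintro _ ⟨v, hv, rfl⟩
        exact (out_adj _ _ (ho v hv)).2.2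
      · rw [Set.InjOn.ncard_image]
        · exact hN
        · intro v hv v' hv' h
          exact out_left _ _ _ (ho v hv) (h ▸ ho v' hv')
    intro z hz
    rw [← himg] at hz
    obtain ⟨v, hv, rfl⟩ := hz
    exact ⟨v, ho v hv⟩
  let S : Set (Sym2 (rectSet m n)) := T.impurities ∪ {e | ∃ v z, Out v z ∧ e = s(v, z)}
  have imp_lattice : ∀ {e}, e ∈ T.impurities → ∀ v ∈ e, v ∉ V₃ m n := fun he v hv =>
    notMem_V₃_iff.2 ((T.impurities_subset he).2 v hv)
  have mem_S : ∀ v, ∀ z ∈ V₃ m n, s(v, z) ∈ S ↔ Out v z := by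
    intro v z hz
    constructor
    · rintro (h | ⟨v', z', h, e⟩)
      · exact absurd hz (imp_lattice h z (Sym2.mem_mk_right _ _))
      · rcases Sym2.eq_iff.1 e with ⟨rfl, rfl⟩ | ⟨rfl, rfl⟩
        · exact h
        · exact absurd hz (out_adj _ _ h).2.1
    · exact fun h => Or.inr ⟨v, z, h, rfl⟩
  have hS : S ⊆ (rect m n).edgeSet ∧ ∀ v, ∃! e, e ∈ S ∧ v ∈ e := by
    constructor
    · rintro e (h | ⟨v, z, h, rfl⟩)
      · exact (T.impurities_subset h).1
      · exact (out_adj _ _ h).1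
    · intro v
      have imp_root : ∀ e ∈ T.impurities, v ∈ e → (∃ c, v = (x c).1) ∨ ∃ c, v = (y c).1 := by
        rw [hI]
        rintro _ ⟨c, rfl⟩ hv
        rcases Sym2.mem_iff.1 hv with h | h
        · exact Or.inl ⟨_, h⟩
        · exact Or.inr ⟨_, h⟩
      have uniq_imp : (∀ z, ¬ Out v z) → v ∉ V₃ m n → (∃! e, e ∈ T.impurities ∧ v ∈ e) →
          ∃! e, e ∈ S ∧ v ∈ e := by
        rintro h1 h2 ⟨e, ⟨he, hv⟩, hu⟩
        refine ⟨e, ⟨Or.inl he, hv⟩, ?_⟩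
        rintro e' ⟨he' | ⟨a, b, hab, rfl⟩, hv'⟩
        · exact hu e' ⟨he', hv'⟩
        · rcases Sym2.mem_iff.1 hv' with rfl | rfl
          · exact absurd hab (h1 _)
          · exact absurd (out_adj _ _ hab).2.2 h2
      by_cases hv : v ∈ V₃ m n
      · obtain ⟨u, hu⟩ := out_surj v hv
        refine ⟨s(u, v), ⟨Or.inr ⟨u, v, hu, rfl⟩, Sym2.mem_mk_right _ _⟩, ?_⟩
        rintro e ⟨h | ⟨a, b, hab, rfl⟩, hve⟩
        · exact absurd hv (imp_lattice h v hve)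
        · rcases Sym2.mem_iff.1 hve with rfl | rfl
          · exact absurd hv (out_adj _ _ hab).2.1
          · rw [out_left _ _ _ hab hu]
      · rcases root_or v hv with ⟨z, hz⟩ | ⟨c, rfl⟩ | ⟨c, rfl⟩
        · refine ⟨s(v, z), ⟨Or.inr ⟨v, z, hz, rfl⟩, Sym2.mem_mk_left _ _⟩, ?_⟩
          rintro e ⟨h | ⟨a, b, hab, rfl⟩, hve⟩
          · rcases imp_root e h hve with ⟨c, rfl⟩ | ⟨c, rfl⟩
            · exact absurd hz (not_out_x c z)
            · exact absurd hz (not_out_y c z)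
          · rcases Sym2.mem_iff.1 hve with rfl | rfl
            · rw [out_right _ _ _ hab hz]
            · exact absurd (out_adj _ _ hab).2.2 hv
        · refine uniq_imp (not_out_x c) hv ?_
          rw [hI]
          refine ⟨_, ⟨⟨c, rfl⟩, Sym2.mem_mk_left _ _⟩, ?_⟩
          rintro _ ⟨⟨c', rfl⟩, hc'⟩
          rcases Sym2.mem_iff.1 hc' with h | h
          · rw [xinj (Subtype.ext h)]
          · exact absurd (h ▸ (y (σ c')).2) (notMem_V₂_of_mem_V₁ (x c).2)
        · refine uniq_imp (not_out_y c) hv ?_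
          rw [hI]
          refine ⟨_, ⟨⟨σ.symm c, rfl⟩, by simp⟩, ?_⟩
          rintro _ ⟨⟨c', rfl⟩, hc'⟩
          rcases Sym2.mem_iff.1 hc' with h | h
          · exact absurd (y c).2 (notMem_V₂_of_mem_V₁ (h ▸ (x c').2))
          · have : c = σ c' := yinj (Subtype.ext h)
            simp [this]
  have hS₁ : matchedGraph S (V₁ m n) = T.F₁ := by
    ext a b
    rw [Compat.adj_iff (f := f) (fun w z hz => (mem_S _ z hz).trans (out₁ w z)) isClass_V₁ hfm,
      ← hf.adj_iff]
  have hS₂ : matchedGraph S (V₂ m n) = T.F₂ := by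
    ext a b
    rw [Compat.adj_iff (f := g) (fun w z hz => (mem_S _ z hz).trans (out₂ w z)) isClass_V₂ hgm,
      ← hg.adj_iff]
  have hSI : S ∩ E₂ m n = T.impurities := by
    ext e
    constructor
    · rintro ⟨h | ⟨v, z, h, rfl⟩, -, he⟩
      · exact h
      · exact absurd (out_adj _ _ h).2.2 (notMem_V₃_iff.2 (he z (Sym2.mem_mk_right _ _)))
    · exact fun h => ⟨Or.inl h, T.impurities_subset h⟩
  refine ⟨⟨S, hS⟩, ?_⟩
  obtain ⟨F₁, F₂, I⟩ := T
  simp only [DimerCovering.toPairedForests, PairedForests.mk.injEq]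
  exact ⟨hS₁, hS₂, hSI⟩

end PairedForests
end RadialGraph

open RadialGraph in
theorem theorem1 (m n : ℕ) (hmn : Odd (m + n)) :
    ∃ Φ : DimerCovering (rect m n) ≃ PairedForests m n ((m + n + 1) / 2),
      ∀ M : DimerCovering (rect m n),
        (Φ M).impurities = M.1 ∩ E₂ m n ∧
        (∀ x y : V₁ m n, (Φ M).F₁.Adj x y ↔ (G₁ m n).Adj x y ∧ MatchedMiddle M.1 x.1 y.1) ∧
        (∀ x y : V₂ m n, (Φ M).F₂.Adj x y ↔ (G₂ m n).Adj x y ∧ MatchedMiddle M.1 x.1 y.1) := by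
  refine ⟨Equiv.ofBijective DimerCovering.toPairedForests
    ⟨DimerCovering.toPairedForests_injective, PairedForests.exists_toPairedForests hmn⟩,
    fun M => ⟨rfl, fun _ _ => Iff.rfl, fun _ _ => Iff.rfl⟩⟩
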